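/- **Setting.** Graphs are finite, simple and undirected on a nonempty node set $V$ with $n=|V|$. Two graphs on $V$ are neighbours if their edge sets differ in exactly one edge. A randomized algorithm $M$ with outputs in $2^V$ is $(\varepsilon,\delta)$-differentially private if $\Pr[M(G)\in A]\le e^{\varepsilon}\Pr[M(G')\in A]+\delta$ for all neighbours $G,G'$ and all $A\subseteq 2^V$. For $S\subseteq V$, $\deg_S(u)$ is the number of neighbours of $u$ in $S$ and $\rho(S)=|E(S)|/|S|$. Put $\varepsilon'=\frac{(1-e^{-1})\varepsilon}{24\ln(4/\delta)}$, $c=\frac1{\varepsilon'}+1$, and fix a cut-off $\theta\in[0,\ln n]$. **PhaseDenseDP** starts with $S_0=V$. In phase $i$ (executed as long as $S_i\ne\emptyset$) it samples, independently, a geometric time $T_u\in\{1,2,\dots\}$ with success probability $\exp(-\varepsilon'(\deg_{S_i}(u)+c))$ for each $u\in S_i$, and a Laplace variable $\mathrm{Lap}\big(\frac{4\ln n}{|S_i|\varepsilon}\big)$ (with mean $0$ and this scale). It puts $\widehat{\rho}_i=\rho(S_i)+\frac{16}{\varepsilon}\ln n+\mathrm{Lap}\big(\frac{4\ln n}{|S_i|\varepsilon}\big)$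 and $T_i=4\ln n\cdot\exp(\varepsilon'(4\widehat\rho_i+c))$, except that $T_i=\infty$ if $|S_i|\le\theta$, and $S_{i+1}=\{u\in S_i: T_u>T_i\}$. At the end it returns a set from the distinct sets $S_i$ of the executed phases, with probability proportional to $e^{\varepsilon\rho(S_i)/2}$. **MRDenseDP** is its MapReduce implementation on key-value records. Initially every node $u$ is announced by an empty record $\langle u;\,\rangle$, and every edge $uv$ is emitted as $\langle u,v\rangle$ and $\langle v,u\rangle$. In each phase: * The reducer of the key $u$ receives the set $N_u$ of all values emitted under $u$. If $u\in N_u$, then $u$ is ignored; the keys that are not ignored form $S_i$. The collected degrees $|N_u|$ give $\rho(S_i)=\frac{1}{2|S_i|}\sum_{u\in S_i}|N_u|$. * $T_u$ (with $|N_u|$ as the degree), $\widehat\rho_i$ and $T_i$ are sampled as above. * The mapper of $u\in S_i$ emits $\langle u,u\rangle$ if $T_u\le T_i$; otherwise it emits $\langle u;\,\rangle$ and $\langle v,u\rangle$ for every $v\in N_u$. The algorithm stops when $S_i=\emptyset$ and selects its output from the distinct pairs $(S_i,\rho(S_i))$ of the executed phases as above. **Statement.** There is an absolute constant $C>0$ such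 that, for every such $V$, every $\varepsilon\in(0,1]$, $\delta\in(2n^{-2},1)$ and $\theta\in[0,\ln n]$: 1. MRDenseDP is $(\varepsilon,\delta)$-differentially private; 2. on every graph $G$ on $V$, with probability at least $1-1/n^2$, MRDenseDP terminates after at most $C\ln n$ phases; 3. each phase of MRDenseDP is equivalent to the corresponding phase of PhaseDenseDP: on every graph $G$ on $V$ and for every $k$, the joint law of the current set and of the list of the pairs $(S_i,\rho(S_i))$ of all executed phases, after $k$ passes of the while loop (fewer if the algorithm stopped before), is the same for both algorithms. -/

import Mathlib

noncomputable section

open MeasureTheory ProbabilityTheory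
open scoped ENNReal Classical

namespace DenseDP

/-! ### Differential privacy for graph mechanisms -/

/-- Neighbouring graphs: same node set, edge sets differing in exactly one edge. -/
def Neighboring {V : Type*} (G G' : SimpleGraph V) : Prop :=
  ∃ e : Sym2 V, symmDiff G.edgeSet G'.edgeSet = {e}

/-- `outProb G A` is the probability that the mechanism, run on `G`, outputs an element of `A`. -/
def IsDifferentiallyPrivate {V O : Type*} (outProb : SimpleGraph V → Set O → ℝ≥0∞)
    (ε δ : ℝ) : Prop :=
  ∀ G G' : SimpleGraph V, Neighboring G G' → ∀ A : Set O,
    outProb G A ≤ ENNReal.ofReal (Real.exp ε) * outProb G' A + ENNReal.ofReal δ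

/-! ### Parameters and random samples shared by the two algorithms -/

/-- `ε' = (1 - e⁻¹) ε / (24 ln (4/δ))`. -/
def epsPrime (ε δ : ℝ) : ℝ := (1 - Real.exp (-1)) * ε / (24 * Real.log (4 / δ))

/-- `c = 1/ε' + 1`. -/
def shift (ε δ : ℝ) : ℝ := 1 / epsPrime ε δ + 1

/-- `P_u = exp (-ε' (deg u + c))` as a function of the degree. -/
def removalProb (ε δ : ℝ) (deg : ℕ) : ℝ :=
  Real.exp (-epsPrime ε δ * (deg + shift ε δ))

/-- `T_u` : the number of the first success in independent trials with success probability `p`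
(values `1, 2, 3, …`); Mathlib's geometric law counts the failures before the first success.
The probabilities used below lie in `(0, 1)`, so the projection onto `[0, 1]` changes nothing. -/
def removalTimeLaw (p : ℝ) : Measure ℕ :=
  (geometricMeasure (Set.projIcc 0 1 zero_le_one p)).map (· + 1)

/-- The Laplace law with mean `0` and scale `b`. -/
def laplaceLaw (b : ℝ) : Measure ℝ :=
  volume.withDensity fun x => ENNReal.ofReal (1 / (2 * b) * Real.exp (-|x| / b))

/-- The fresh randomness of one phase with current node set `S` and degrees `deg`: Laplace noise of
scale `4 ln n / (|S| ε)` and, independently, independent removal times `T_u` for `u ∈ S`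
(no time is sampled for the other nodes). -/
def phaseNoise {V : Type*} [Fintype V] (ε δ : ℝ) (S : Finset V) (deg : V → ℕ) :
    Measure (ℝ × (V → ℕ)) :=
  (laplaceLaw (4 * Real.log (Fintype.card V) / (S.card * ε))).prod
    (Measure.pi fun u =>
      if u ∈ S then removalTimeLaw (removalProb ε δ (deg u)) else Measure.dirac 0)

/-- The noisy density `ρ + (16/ε) ln n + Lap`. -/
def noisyDensity (n : ℕ) (ε : ℝ) (ρ : ℚ) (lap : ℝ) : ℝ :=
  ρ + 16 / ε * Real.log n + lap

/-- `T_i = 4 ln n / exp (-ε' (4 ρ̂ + c))`. -/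
def timeLimit (n : ℕ) (ε δ ρhat : ℝ) : ℝ :=
  4 * Real.log n / Real.exp (-epsPrime ε δ * (4 * ρhat + shift ε δ))

/-- Whether a node with sampled time `t` is removed in a phase with `s` current nodes, density `ρ`
and noise `lap`: its time is at most `T_i`, where `T_i = ∞` if at most `θ` nodes are left. -/
def IsRemoved (n : ℕ) (ε δ θ : ℝ) (s : ℕ) (ρ : ℚ) (lap : ℝ) (t : ℕ) : Prop :=
  (s : ℝ) ≤ θ ∨ (t : ℝ) ≤ timeLimit n ε δ (noisyDensity n ε ρ lap)

/-- The final selection: from the distinct candidates `(S_i, ρ(S_i))` return `S_i` with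
probability proportional to `exp (ε ρ(S_i) / 2)`. -/
def selectLaw {V : Type*} (ε : ℝ) (cands : List (Finset V × ℚ)) :
    @Measure (Finset V) ⊤ :=
  ∑ p ∈ cands.toFinset,
    ENNReal.ofReal (Real.exp (ε * p.2 / 2) / ∑ q ∈ cands.toFinset, Real.exp (ε * q.2 / 2)) •
      @Measure.dirac (Finset V) ⊤ p.1

/-! ### The MapReduce algorithm `MRDenseDP` -/

/-- A key-value record. `(u, some v)` is the pair `⟨u, v⟩`; `(u, none)` is the record with key `u`
and no value, which only announces that node `u` is still present (it is needed for nodes without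
remaining neighbours). -/
abbrev Record (V : Type*) := V × Option V

/-- The keys handed to the first reduce sub-phase. -/
def keys {V : Type*} (M : Finset (Record V)) : Finset V := M.image Prod.fst

/-- The values `{v₁, v₂, …}` collected under the key `u`. -/
def values {V : Type*} [Fintype V] (M : Finset (Record V)) (u : V) : Finset V :=
  Finset.univ.filter fun v => (u, some v) ∈ M

/-- `S_i`: the keys that are not ignored; `u` is ignored if it occurs among its own values. -/
def currentNodes {V : Type*} [Fintype V] (M : Finset (Record V)) : Finset V :=
  (keys M).filter fun u => u ∉ values M u

/-- `deg_{S_i}(u)` as computed by the reducer of the key `u`. -/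
def recordDegree {V : Type*} [Fintype V] (M : Finset (Record V)) (u : V) : ℕ :=
  (values M u).card

/-- `ρ(S_i)`: half the sum of the collected degrees, divided by `|S_i|`. -/
def recordDensity {V : Type*} [Fintype V] (M : Finset (Record V)) : ℚ :=
  (∑ u ∈ currentNodes M, (recordDegree M u : ℚ)) / 2 / (currentNodes M).card

/-- The records emitted before the first phase: every node is announced, and every edge is emitted
in both directions. -/
def initialRecords {V : Type*} [Fintype V] (G : SimpleGraph V) : Finset (Record V) :=
  (Finset.univ.image fun u : V => ((u, none) : Record V)) ∪
    ((Finset.univ.filter fun p : V × V => G.Adj p.1 p.2).image fun p => (p.1, some p.2))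

/-- The records emitted by the map sub-phase on input `⟨u, {v₁, v₂, …}⟩`: the marker `⟨u, u⟩` if `u`
is removed; otherwise `u` stays announced and `⟨v, u⟩` is emitted for every `v` in the list. -/
def mapNode {V : Type*} [Fintype V] (M : Finset (Record V)) (removed : V → Prop) (u : V) :
    Finset (Record V) :=
  if removed u then {(u, some u)}
  else insert (u, none) ((values M u).image fun v => (v, some u))

/-- Running state: the current records, and the list of pairs `(S_i, ρ(S_i))` of the phases
executed so far, in chronological order. -/
structure MRState (V : Type*) where
  records : Finset (Record V)
  history : List (Finset V × ℚ)

instance {V : Type*} : MeasurableSpace (MRState V) := ⊤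

/-- One phase as a function of its random samples `ω = (noise, times)`. -/
def mrPhase {V : Type*} [Fintype V] (ε δ θ : ℝ) (σ : MRState V) (ω : ℝ × (V → ℕ)) :
    MRState V where
  records := (currentNodes σ.records).biUnion <| mapNode σ.records fun u =>
    IsRemoved (Fintype.card V) ε δ θ (currentNodes σ.records).card
      (recordDensity σ.records) ω.1 (ω.2 u)
  history := σ.history ++ [(currentNodes σ.records, recordDensity σ.records)]

/-- The `while` loop has ended: no node is left. -/
def MRState.Halted {V : Type*} [Fintype V] (σ : MRState V) : Prop :=
  currentNodes σ.records = ∅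

/-- The law of the state after one more pass of the `while` loop. -/
def mrStepLaw {V : Type*} [Fintype V] (ε δ θ : ℝ) (σ : MRState V) : Measure (MRState V) :=
  if σ.Halted then Measure.dirac σ
  else (phaseNoise ε δ (currentNodes σ.records) (recordDegree σ.records)).map (mrPhase ε δ θ σ)

/-- The law of the state after `k` passes of the `while` loop (fewer if it ended before). -/
def mrLaw {V : Type*} [Fintype V] (ε δ θ : ℝ) (G : SimpleGraph V) : ℕ → Measure (MRState V)
  | 0 => Measure.dirac ⟨initialRecords G, []⟩
  | k + 1 => (mrLaw ε δ θ G k).bind (mrStepLaw ε δ θ)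

/-- Probability that the algorithm terminates and returns an element of `A`: the limit over `k` of
the (nondecreasing) probability that this happens within `k` phases. -/
def mrOutputProb {V : Type*} [Fintype V] (ε δ θ : ℝ) (G : SimpleGraph V)
    (A : Set (Finset V)) : ℝ≥0∞ :=
  ⨆ k, ∫⁻ σ, (if σ.Halted then selectLaw ε σ.history A else 0) ∂(mrLaw ε δ θ G k)

/-- Probability that the algorithm terminates after at most `b` phases. -/
def mrPhasesAtMost {V : Type*} [Fintype V] (ε δ θ : ℝ) (G : SimpleGraph V) (b : ℝ) : ℝ≥0∞ :=
  ⨆ k, mrLaw ε δ θ G k {σ | σ.Halted ∧ (σ.history.length : ℝ) ≤ b}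

/-! ### The reference algorithm `PhaseDenseDP`, working directly on the graph -/

/-- The degree of `u` in the subgraph induced by `S`. -/
def inducedDegree {V : Type*} (G : SimpleGraph V) (S : Finset V) (u : V) : ℕ :=
  (S.filter fun v => G.Adj u v).card

/-- The density `ρ(S) = |E(S)| / |S|`. -/
def density {V : Type*} [Fintype V] (G : SimpleGraph V) (S : Finset V) : ℚ :=
  ((G.edgeFinset.filter fun e => ∀ v ∈ e, v ∈ S).card : ℚ) / S.card

/-- Running state: the current set `S_i`, and the list of the pairs `(S_j, ρ(S_j))` for the phases
executed so far. -/
structure PhaseState (V : Type*) where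
  current : Finset V
  history : List (Finset V × ℚ)

instance {V : Type*} : MeasurableSpace (PhaseState V) := ⊤

/-- One phase as a function of its random samples: all removed nodes are deleted at once. -/
def directPhase {V : Type*} [Fintype V] (ε δ θ : ℝ) (G : SimpleGraph V) (σ : PhaseState V)
    (ω : ℝ × (V → ℕ)) : PhaseState V where
  current := σ.current.filter fun u =>
    ¬ IsRemoved (Fintype.card V) ε δ θ σ.current.card (density G σ.current) ω.1 (ω.2 u)
  history := σ.history ++ [(σ.current, density G σ.current)]

/-- The law of the state after one more pass of the `while` loop. -/
def directStepLaw {V : Type*} [Fintype V] (ε δ θ : ℝ) (G : SimpleGraph V) (σ : PhaseState V) :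
    Measure (PhaseState V) :=
  if σ.current = ∅ then Measure.dirac σ
  else (phaseNoise ε δ σ.current (inducedDegree G σ.current)).map (directPhase ε δ θ G σ)

/-- The law of the state after `k` passes of the `while` loop (fewer if it ended before). -/
def directLaw {V : Type*} [Fintype V] (ε δ θ : ℝ) (G : SimpleGraph V) :
    ℕ → Measure (PhaseState V)
  | 0 => Measure.dirac ⟨Finset.univ, []⟩
  | k + 1 => (directLaw ε δ θ G k).bind (directStepLaw ε δ θ G)

/-- What a state of the MapReduce run says about `S_i` and the past phases. -/
def MRState.toPhaseState {V : Type*} [Fintype V] (σ : MRState V) : PhaseState V :=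
  ⟨currentNodes σ.records, σ.history⟩

end DenseDP

end

/-!
The MapReduce phases simulate the phases of the reference algorithm because the records always
represent the graph induced on the current nodes (`Represents`): a removed node leaves only its own
marker and no longer sends itself to its neighbours. Hence the laws agree (`map_mrLaw`), and
everything else can be proved for the reference algorithm. There one phase acts on a function of the
surviving set `R` by an explicit formula (`runValue_succ`): integrate over the Laplace noise, and
given the noise let every node survive independently, with probability `(1 - p_u) ^ ⌊T_i⌋`.

*Few phases.* If the noise does not push `ρ̂` below `ρ`, at most half of the nodes have degree above
`4 ρ̂`, and each of the others survives with probability `O(n⁻⁴)`; the noise does so with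
probability at most `e^{-4|S|}`. Therefore the expectation of `|R| ^ 4` is at most a small constant
times `|S| ^ 4` (`phaseMean_card_pow_le`), and the probability of not having stopped decays
geometrically in the number of phases.

*Privacy.* Let the graphs differ in the edge `xy`. As long as both endpoints are present, a phase has
the following effects on the likelihood ratio.

* The density changes by at most `1 / |S|`, so the Laplace noise costs `ε / (4 ln n)`.
* The removal of an endpoint costs `ε'`, and happens only once.
* The survival of an endpoint costs a constant times `ε'` times its expected number of successes in
  the trials of the phase. Surviving expected `t` successes has probability at most `e^{-t}`, so
  `t` stays below `ln (4/δ)` except with probability `δ / 4`.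

When an endpoint has been removed, the two runs coincide up to the final selection, which costs
`ε / 4` (`EdgeClose.runValue_le_of_not_mem`). The fourth moment bound shows that the number of phases
containing both endpoints exceeds `2.5 ln n` with probability at most `n⁻² ≤ δ / 2`; the fourth power
is large enough to make the rate of decay almost that of deterministic halving, which the constant
`2.5` requires. `EdgeClose.runValue_le` carries all budgets through a single induction on the number
of passes, with the failure probabilities as additive error terms, and `budget_le` adds up the costs.
-/

noncomputable section

open MeasureTheory ProbabilityTheory
open scoped ENNReal Classical

namespace DenseDP

/-! ### The random samples of one phase -/

/-- The density of the Laplace law with mean `0` and scale `b`. -/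
def laplaceDensity (b x : ℝ) : ℝ := 1 / (2 * b) * Real.exp (-|x| / b)

lemma laplaceDensity_nonneg {b : ℝ} (hb : 0 < b) (x : ℝ) : 0 ≤ laplaceDensity b x := by
  unfold laplaceDensity; positivity

lemma measurable_laplaceDensity (b : ℝ) : Measurable (laplaceDensity b) := by
  unfold laplaceDensity
  fun_prop

lemma lintegral_laplaceDensity {b : ℝ} (hb : 0 < b) :
    ∫⁻ x, ENNReal.ofReal (laplaceDensity b x) = 1 := by
  have h : ∫ x, laplaceDensity b x = 1 := by
    have h1 := integral_comp_abs (f := fun x => 1 / (2 * b) * Real.exp (-x / b))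
    have h2 := integral_exp_mul_Ioi (a := -1 / b) (by apply div_neg_of_neg_of_pos <;> linarith) 0
    have h3 : (fun x : ℝ => Real.exp (-x / b)) = fun x => Real.exp (-1 / b * x) := by
      funext x
      congr 1
      ring
    simp only [laplaceDensity]
    rw [h1, integral_const_mul]
    rw [h3, h2, mul_zero, Real.exp_zero]
    field_simp
  rw [← ofReal_integral_eq_lintegral_ofReal _ (ae_of_all _ (laplaceDensity_nonneg hb)), h]
  · simp
  · exact Integrable.of_integral_ne_zero (by rw [h]; exact one_ne_zero)

lemma isProbabilityMeasure_laplaceLaw {b : ℝ} (hb : 0 < b) :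
    IsProbabilityMeasure (laplaceLaw b) :=
  ⟨by rw [laplaceLaw, withDensity_apply _ MeasurableSet.univ, Measure.restrict_univ]
      exact lintegral_laplaceDensity hb⟩

lemma lintegral_laplaceLaw (b : ℝ) {f : ℝ → ℝ≥0∞} (hf : Measurable f) :
    ∫⁻ x, f x ∂(laplaceLaw b) = ∫⁻ x, ENNReal.ofReal (laplaceDensity b x) * f x :=
  lintegral_withDensity_eq_lintegral_mul _ (measurable_laplaceDensity b).ennreal_ofReal hf

lemma laplaceDensity_le_shift {b : ℝ} (hb : 0 < b) (x a : ℝ) :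
    laplaceDensity b x ≤ Real.exp (|a| / b) * laplaceDensity b (x + a) := by
  unfold laplaceDensity
  rw [mul_left_comm, ← Real.exp_add, ← add_div]
  gcongr
  have := abs_add_le x a
  linarith

/-- Lower tail of the Laplace law, without the optimal factor `1 / 2`. -/
lemma lintegral_laplaceDensity_tail {b a : ℝ} (hb : 0 < b) (ha : 0 ≤ a) :
    ∫⁻ x in Set.Iio (-a), ENNReal.ofReal (laplaceDensity b x) ≤
      ENNReal.ofReal (Real.exp (-a / b)) := by
  -- below `-a` a translation by `a` multiplies the density by exactly `exp (a / b)`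
  calc ∫⁻ x in Set.Iio (-a), ENNReal.ofReal (laplaceDensity b x)
      ≤ ∫⁻ x in Set.Iio (-a), ENNReal.ofReal (Real.exp (-a / b)) *
          ENNReal.ofReal (laplaceDensity b (x + a)) := by
        refine setLIntegral_mono' measurableSet_Iio fun x hx => ?_
        rw [← ENNReal.ofReal_mul (Real.exp_nonneg _)]
        refine ENNReal.ofReal_le_ofReal (le_of_eq ?_)
        unfold laplaceDensity
        rw [mul_left_comm, ← Real.exp_add, ← add_div]
        have hx : x < -a := hx
        rw [abs_of_neg (by linarith), abs_of_neg (by linarith)]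
        congr 3
        ring
    _ ≤ ∫⁻ x, ENNReal.ofReal (Real.exp (-a / b)) * ENNReal.ofReal (laplaceDensity b (x + a)) :=
        setLIntegral_le_lintegral _ _
    _ = ENNReal.ofReal (Real.exp (-a / b)) := by
        rw [lintegral_const_mul _ (by
          exact ((measurable_laplaceDensity b).comp (measurable_add_const a)).ennreal_ofReal),
          lintegral_add_right_eq_self (fun x => ENNReal.ofReal (laplaceDensity b x)),
          lintegral_laplaceDensity hb, mul_one]

instance isProbabilityMeasure_removalTimeLaw (p : ℝ) :
    IsProbabilityMeasure (removalTimeLaw p) :=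
  Measure.isProbabilityMeasure_map (by fun_prop)

lemma removalTimeLaw_Iic {p : ℝ} (h0 : 0 < p) (h1 : p ≤ 1) (N : ℕ) :
    removalTimeLaw p (Set.Iic N) = ENNReal.ofReal (1 - (1 - p) ^ N) := by
  have hp : (Set.projIcc 0 1 zero_le_one p : unitInterval) = ⟨p, h0.le, h1⟩ :=
    Set.projIcc_of_mem _ ⟨h0.le, h1⟩
  have hne : (⟨p, h0.le, h1⟩ : unitInterval) ≠ 0 := fun h => h0.ne' (congrArg Subtype.val h)
  have hset : (fun k : ℕ => k + 1) ⁻¹' Set.Iic N = ((Finset.range N : Finset ℕ) : Set ℕ) := by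
    ext k
    simp
  rw [removalTimeLaw, hp, Measure.map_apply (by fun_prop) measurableSet_Iic, hset,
    ← sum_measure_singleton]
  simp only [geometricMeasure_singleton hne]
  rw [← ENNReal.ofReal_sum_of_nonneg fun k _ =>
    geometricMeasure_nonneg (⟨p, h0.le, h1⟩ : unitInterval) k]
  congr 1
  rw [← Finset.sum_mul]
  have := geom_sum_mul (1 - p) N
  linarith

lemma removalTimeLaw_Ioi {p : ℝ} (h0 : 0 < p) (h1 : p ≤ 1) (N : ℕ) :
    removalTimeLaw p (Set.Ioi N) = ENNReal.ofReal ((1 - p) ^ N) := by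
  rw [← Set.compl_Iic, prob_compl_eq_one_sub measurableSet_Iic, removalTimeLaw_Iic h0 h1,
    ← ENNReal.ofReal_one, ← ENNReal.ofReal_sub _ (by
      have := pow_le_one₀ (n := N) (sub_nonneg.2 h1) (by linarith); linarith)]
  congr 1
  ring

lemma removalProb_pos (ε δ : ℝ) (d : ℕ) : 0 < removalProb ε δ d := Real.exp_pos _

lemma removalProb_le {ε δ : ℝ} (h : 0 < epsPrime ε δ) (d : ℕ) :
    removalProb ε δ d ≤ Real.exp (-1) := by
  unfold removalProb shift
  apply Real.exp_le_exp.2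
  have h1 : epsPrime ε δ * (1 / epsPrime ε δ) = 1 := by field_simp
  have h2 : 0 ≤ epsPrime ε δ * d := by positivity
  nlinarith

lemma exp_neg_one_lt_one : Real.exp (-1) < 1 := by
  rw [← Real.exp_zero]
  exact Real.exp_lt_exp.2 (by norm_num)

lemma removalProb_lt_one {ε δ : ℝ} (h : 0 < epsPrime ε δ) (d : ℕ) : removalProb ε δ d < 1 :=
  (removalProb_le h d).trans_lt exp_neg_one_lt_one

/-- The number of trials `⌊T_i⌋` that a node has to survive in a phase with noise `z`. -/
def trials (n : ℕ) (ε δ : ℝ) (ρ : ℚ) (z : ℝ) : ℕ :=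
  ⌊timeLimit n ε δ (noisyDensity n ε ρ z)⌋₊

/-- The probability that a node of degree `d` survives a phase with `s` current nodes, density `ρ`
and noise `z`. -/
def survivalProb (n : ℕ) (ε δ θ : ℝ) (s : ℕ) (ρ : ℚ) (d : ℕ) (z : ℝ) : ℝ :=
  if (s : ℝ) ≤ θ then 0 else (1 - removalProb ε δ d) ^ trials n ε δ ρ z

section survivalProb

variable {n : ℕ} {ε δ θ : ℝ} {s : ℕ} {ρ : ℚ} {d : ℕ} {z : ℝ}

lemma survivalProb_nonneg (h : 0 < epsPrime ε δ) : 0 ≤ survivalProb n ε δ θ s ρ d z := by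
  have := removalProb_lt_one h d
  unfold survivalProb
  split_ifs
  · exact le_rfl
  · exact pow_nonneg (by linarith) _

lemma survivalProb_le_one (h : 0 < epsPrime ε δ) : survivalProb n ε δ θ s ρ d z ≤ 1 := by
  have := removalProb_lt_one h d
  have := removalProb_pos ε δ d
  unfold survivalProb
  split_ifs
  · exact zero_le_one
  · exact pow_le_one₀ (by linarith) (by linarith)

lemma timeLimit_nonneg (n : ℕ) (ε δ x : ℝ) : 0 ≤ timeLimit n ε δ x :=
  div_nonneg (mul_nonneg (by norm_num) (Real.log_natCast_nonneg n)) (Real.exp_nonneg _)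

lemma measurable_timeLimit (n : ℕ) (ε δ : ℝ) (ρ : ℚ) :
    Measurable fun z => timeLimit n ε δ (noisyDensity n ε ρ z) := by
  unfold timeLimit noisyDensity
  fun_prop

lemma measurable_survivalProb : Measurable (survivalProb n ε δ θ s ρ d) := by
  have h : Measurable fun z => (1 - removalProb ε δ d) ^ trials n ε δ ρ z :=
    (measurable_from_top (f := fun k : ℕ => (1 - removalProb ε δ d) ^ k)).comp
      (Nat.measurable_floor.comp (measurable_timeLimit n ε δ ρ))
  unfold survivalProb
  split_ifs
  · exact measurable_const
  · exact h

lemma removalTimeLaw_not_isRemoved (h : 0 < epsPrime ε δ) :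
    removalTimeLaw (removalProb ε δ d) {t | ¬ IsRemoved n ε δ θ s ρ z t} =
      ENNReal.ofReal (survivalProb n ε δ θ s ρ d z) := by
  unfold IsRemoved survivalProb
  split_ifs with hs
  · simp [hs]
  · rw [← removalTimeLaw_Ioi (removalProb_pos ε δ d) (removalProb_lt_one h d).le]
    congr 1
    ext t
    simp [hs, trials, Nat.floor_lt (timeLimit_nonneg _ _ _ _)]

lemma removalTimeLaw_isRemoved (h : 0 < epsPrime ε δ) :
    removalTimeLaw (removalProb ε δ d) {t | IsRemoved n ε δ θ s ρ z t} =
      ENNReal.ofReal (1 - survivalProb n ε δ θ s ρ d z) := by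
  have h1 : {t : ℕ | IsRemoved n ε δ θ s ρ z t} = {t | ¬ IsRemoved n ε δ θ s ρ z t}ᶜ := by
    ext t; simp
  rw [h1, prob_compl_eq_one_sub (MeasurableSet.of_discrete), removalTimeLaw_not_isRemoved h,
    ← ENNReal.ofReal_one, ← ENNReal.ofReal_sub _ (survivalProb_nonneg h)]

end survivalProb

/-! ### The law of the surviving set -/

/-- The probability that exactly the nodes of `R` survive if every `u ∈ S` survives independently
with probability `q u`. -/
def setWeight {V : Type*} (S : Finset V) (q : V → ℝ) (R : Finset V) : ℝ :=
  ∏ u ∈ S, if u ∈ R then q u else 1 - q u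

section setWeight

variable {V : Type*} {S R : Finset V} {q q' : V → ℝ}

lemma setWeight_nonneg (h0 : ∀ u ∈ S, 0 ≤ q u) (h1 : ∀ u ∈ S, q u ≤ 1) : 0 ≤ setWeight S q R :=
  Finset.prod_nonneg fun u hu => by
    split_ifs
    · exact h0 u hu
    · linarith [h1 u hu]

lemma setWeight_eq_mul (hR : R ⊆ S) :
    setWeight S q R = (∏ u ∈ R, q u) * ∏ u ∈ S \ R, (1 - q u) := by
  unfold setWeight
  rw [Finset.prod_ite]
  congr 1
  · congr 1
    ext u
    simp only [Finset.mem_filter]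
    exact ⟨fun h => h.2, fun h => ⟨hR h, h⟩⟩
  · congr 1
    ext u
    simp

lemma setWeight_congr (h : ∀ u ∈ S, q u = q' u) : setWeight S q R = setWeight S q' R :=
  Finset.prod_congr rfl fun u hu => by rw [h u hu]

lemma sum_setWeight (S : Finset V) (q : V → ℝ) : ∑ R ∈ S.powerset, setWeight S q R = 1 := by
  have h := Finset.prod_add q (fun u => 1 - q u) S
  simp only [add_sub_cancel, Finset.prod_const_one] at h
  rw [h]
  exact Finset.sum_congr rfl fun R hR => setWeight_eq_mul (Finset.mem_powerset.1 hR)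

/-- The marginal of one node: the sets containing `x` have total weight `q x`. -/
lemma sum_setWeight_mem {x : V} (hx : x ∈ S) (q : V → ℝ) :
    ∑ R ∈ S.powerset, (if x ∈ R then setWeight S q R else 0) = q x := by
  have h := Finset.prod_add q (fun u => if u = x then 0 else 1 - q u) S
  have h2 : ∏ u ∈ S, (q u + if u = x then 0 else 1 - q u) = q x := by
    rw [Finset.prod_eq_single_of_mem x hx]
    · simp
    · intro u _ hu
      simp [hu]
  rw [← h2, h]
  refine Finset.sum_congr rfl fun R hR => ?_
  have hR := Finset.mem_powerset.1 hR
  split_ifs with hxR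
  · rw [setWeight_eq_mul hR]
    congr 1
    refine Finset.prod_congr rfl fun u hu => ?_
    rw [if_neg]
    rintro rfl
    exact (Finset.mem_sdiff.1 hu).2 hxR
  · rw [Finset.prod_eq_zero (Finset.mem_sdiff.2 ⟨hx, hxR⟩) (by simp), mul_zero]

lemma lintegral_pi_filter [Fintype V] (ν : V → Measure ℕ) [∀ u, IsProbabilityMeasure (ν u)]
    (P : ℕ → Prop) (h0 : ∀ u ∈ S, 0 ≤ q u) (h1 : ∀ u ∈ S, q u ≤ 1)
    (hν : ∀ u ∈ S, ν u {t | ¬ P t} = ENNReal.ofReal (q u))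
    (hν' : ∀ u ∈ S, ν u {t | P t} = ENNReal.ofReal (1 - q u)) (f : Finset V → ℝ≥0∞) :
    ∫⁻ t, f (S.filter fun u => ¬ P (t u)) ∂(Measure.pi ν) =
      ∑ R ∈ S.powerset, ENNReal.ofReal (setWeight S q R) * f R := by
  -- the event that exactly `R` survives is a box
  let A : Finset V → V → Set ℕ := fun R u =>
    if u ∈ S then (if u ∈ R then {t | ¬ P t} else {t | P t}) else Set.univ
  have hA : ∀ R ∈ S.powerset, ∀ t : V → ℕ,
      t ∈ Set.univ.pi (A R) ↔ (S.filter fun u => ¬ P (t u)) = R := by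
    intro R hR t
    have hR := Finset.mem_powerset.1 hR
    simp only [Set.mem_univ_pi, A, Finset.ext_iff, Finset.mem_filter]
    refine forall_congr' fun u => ?_
    by_cases hS : u ∈ S
    · by_cases hu : u ∈ R <;> simp [hS, hu]
    · have : u ∉ R := fun h => hS (hR h)
      simp [hS, this]
  have hmeas : ∀ R, MeasurableSet (Set.univ.pi (A R)) := fun R =>
    MeasurableSet.univ_pi fun u => MeasurableSet.of_discrete
  have hf : ∀ t : V → ℕ, f (S.filter fun u => ¬ P (t u)) =
      ∑ R ∈ S.powerset, (Set.univ.pi (A R)).indicator (fun _ => f R) t := by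
    intro t
    rw [Finset.sum_eq_single_of_mem (S.filter fun u => ¬ P (t u))
      (Finset.mem_powerset.2 (Finset.filter_subset _ _))]
    · rw [Set.indicator_of_mem ((hA _ (Finset.mem_powerset.2 (Finset.filter_subset _ _)) t).2 rfl)]
    · intro R hR hne
      rw [Set.indicator_of_notMem fun h => hne ((hA R hR t).1 h).symm]
  simp only [hf]
  rw [lintegral_finsetSum _ fun R _ => measurable_const.indicator (hmeas R)]
  refine Finset.sum_congr rfl fun R hR => ?_
  rw [lintegral_indicator_const (hmeas R), Measure.pi_pi, mul_comm]
  congr 1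
  rw [setWeight, ENNReal.ofReal_prod_of_nonneg]
  · rw [← Finset.prod_subset (Finset.subset_univ S) (f := fun u => ν u (A R u))]
    · refine Finset.prod_congr rfl fun u hu => ?_
      simp only [A, hu, if_true]
      split_ifs
      · exact hν u hu
      · exact hν' u hu
    · intro u _ hu
      simp [A, hu]
  · intro u hu
    split_ifs
    · exact h0 u hu
    · linarith [h1 u hu]

end setWeight

/-- The scale of the Laplace noise in a phase with `s` current nodes. -/
def noiseScale (n : ℕ) (ε : ℝ) (s : ℕ) : ℝ := 4 * Real.log n / (s * ε)

section phase

variable {V : Type*} [Fintype V] {ε δ θ : ℝ}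

/-- The vector of removal decisions takes finitely many values and depends measurably on the
samples; every function of it is therefore measurable. -/
lemma measurable_of_isRemoved {α : Type*} [MeasurableSpace α] (n s : ℕ) (ρ : ℚ)
    (f : (V → Prop) → α) :
    Measurable fun ω : ℝ × (V → ℕ) => f fun u => IsRemoved n ε δ θ s ρ ω.1 (ω.2 u) := by
  have h : Measurable fun (ω : ℝ × (V → ℕ)) (u : V) => IsRemoved n ε δ θ s ρ ω.1 (ω.2 u) := by
    refine measurable_pi_lambda _ fun u => ?_
    unfold IsRemoved
    refine measurable_const.or (measurableSet_setOfPred.1 (measurableSet_le ?_ ?_))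
    · exact (measurable_from_top (f := fun k : ℕ => (k : ℝ))).comp
        ((measurable_pi_apply u).comp measurable_snd)
    · exact (measurable_timeLimit n ε δ ρ).comp measurable_fst
  exact (Measurable.of_discrete (f := f)).comp h

/-- The expectation of a function of the surviving set over the samples of one phase. -/
lemma lintegral_phaseNoise (h : 0 < epsPrime ε δ) (S : Finset V) (deg : V → ℕ) (ρ : ℚ)
    (f : Finset V → ℝ≥0∞) :
    ∫⁻ ω, f (S.filter fun u => ¬ IsRemoved (Fintype.card V) ε δ θ S.card ρ ω.1 (ω.2 u))
        ∂(phaseNoise ε δ S deg) =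
      ∫⁻ z, ENNReal.ofReal (laplaceDensity (noiseScale (Fintype.card V) ε S.card) z) *
        ∑ R ∈ S.powerset, ENNReal.ofReal
          (setWeight S (fun u => survivalProb (Fintype.card V) ε δ θ S.card ρ (deg u) z) R) *
          f R := by
  have inst : ∀ u, IsProbabilityMeasure
      (if u ∈ S then removalTimeLaw (removalProb ε δ (deg u)) else Measure.dirac 0) := by
    intro u
    split_ifs <;> infer_instance
  have hm : Measurable fun ω : ℝ × (V → ℕ) =>
      f (S.filter fun u => ¬ IsRemoved (Fintype.card V) ε δ θ S.card ρ ω.1 (ω.2 u)) :=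
    measurable_of_isRemoved (Fintype.card V) S.card ρ fun r => f (S.filter fun u => ¬ r u)
  rw [phaseNoise, lintegral_prod _ hm.aemeasurable, lintegral_laplaceLaw _ hm.lintegral_prod_right']
  refine lintegral_congr fun z => ?_
  congr 1
  refine lintegral_pi_filter
    (fun u => if u ∈ S then removalTimeLaw (removalProb ε δ (deg u)) else Measure.dirac 0)
    (S := S) (q := fun u => survivalProb (Fintype.card V) ε δ θ S.card ρ (deg u) z)
    (fun t => IsRemoved (Fintype.card V) ε δ θ S.card ρ z t)
    (fun u _ => survivalProb_nonneg h) (fun u _ => survivalProb_le_one h) ?_ ?_ f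
  · intro u hu
    rw [if_pos hu]
    exact removalTimeLaw_not_isRemoved h
  · intro u hu
    rw [if_pos hu]
    exact removalTimeLaw_isRemoved h

end phase

/-! ### Induced subgraphs: degrees and density -/

section graph

variable {V : Type*} [Fintype V] (G : SimpleGraph V) (S : Finset V)

/-- The number of edges inside `S`. -/
def edgeCount : ℕ := (G.edgeFinset.filter fun e => ∀ v ∈ e, v ∈ S).card

lemma density_eq : density G S = edgeCount G S / S.card := rfl

lemma sum_inducedDegree : ∑ u ∈ S, inducedDegree G S u = 2 * edgeCount G S := by
  let H : SimpleGraph V :=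
    { Adj := fun u v => G.Adj u v ∧ u ∈ S ∧ v ∈ S
      symm := ⟨fun u v h => ⟨h.1.symm, h.2.2, h.2.1⟩⟩
      loopless := ⟨fun u h => G.loopless.irrefl u h.1⟩ }
  have hE : H.edgeFinset = G.edgeFinset.filter fun e => ∀ v ∈ e, v ∈ S := by
    ext e
    induction e with
    | _ a b => simp [H]
  have hd : ∀ u, H.degree u = if u ∈ S then inducedDegree G S u else 0 := by
    intro u
    rw [← SimpleGraph.card_neighborFinset_eq_degree]
    split_ifs with hu
    · unfold inducedDegree
      congr 1
      ext v
      simp [H, hu, and_comm]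
    · rw [Finset.card_eq_zero]
      ext v
      simp [H, hu]
  have h := H.sum_degrees_eq_twice_card_edges
  rw [hE] at h
  rw [edgeCount, ← h]
  simp only [hd]
  rw [Finset.sum_ite_mem, Finset.univ_inter]

lemma density_eq_sum_degree :
    density G S = (∑ u ∈ S, (inducedDegree G S u : ℚ)) / 2 / S.card := by
  rw [density_eq, ← Nat.cast_sum, sum_inducedDegree]
  push_cast
  ring

end graph

/-! ### The records represent the induced subgraph on the current nodes -/

lemma mem_keys {V : Type*} {M : Finset (Record V)} {u : V} : u ∈ keys M ↔ ∃ o, (u, o) ∈ M := by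
  simp [keys]

section MapReduce

variable {V : Type*} [Fintype V] {ε δ θ : ℝ} {G : SimpleGraph V}

/-- The records describe `G` restricted to the current nodes: the values under the key of a current
node are its neighbours among the current nodes. -/
def Represents (G : SimpleGraph V) (M : Finset (Record V)) : Prop :=
  ∀ u ∈ currentNodes M, values M u = (currentNodes M).filter fun v => G.Adj u v

lemma mem_values {M : Finset (Record V)} {u v : V} : v ∈ values M u ↔ (u, some v) ∈ M := by
  simp [values]

lemma mem_currentNodes {M : Finset (Record V)} {u : V} :
    u ∈ currentNodes M ↔ (∃ o, (u, o) ∈ M) ∧ (u, some u) ∉ M := by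
  simp [currentNodes, mem_keys, mem_values]

lemma some_mem_initialRecords {u v : V} : (u, some v) ∈ initialRecords G ↔ G.Adj u v := by
  simp [initialRecords]

lemma currentNodes_initialRecords : currentNodes (initialRecords G) = Finset.univ := by
  ext u
  simp only [mem_currentNodes, some_mem_initialRecords, SimpleGraph.irrefl, not_false_eq_true,
    and_true, Finset.mem_univ, iff_true]
  exact ⟨none, by simp [initialRecords]⟩

lemma represents_initialRecords : Represents G (initialRecords G) := by
  intro u _
  rw [currentNodes_initialRecords]
  ext v
  simp [mem_values, some_mem_initialRecords]

/-- The records emitted by one map sub-phase. -/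
def nextRecords (M : Finset (Record V)) (r : V → Prop) : Finset (Record V) :=
  (currentNodes M).biUnion (mapNode M r)

lemma none_mem_nextRecords {M : Finset (Record V)} {r : V → Prop} {v : V} :
    (v, none) ∈ nextRecords M r ↔ v ∈ currentNodes M ∧ ¬ r v := by
  simp only [nextRecords, Finset.mem_biUnion, mapNode]
  constructor
  · rintro ⟨u, hu, h⟩
    split_ifs at h with hr
    · simp at h
    · simp at h
      subst h
      exact ⟨hu, hr⟩
  · rintro ⟨h, hr⟩
    exact ⟨v, h, by simp [hr]⟩

lemma some_mem_nextRecords {M : Finset (Record V)} {r : V → Prop} {v w : V} :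
    (v, some w) ∈ nextRecords M r ↔
      w ∈ currentNodes M ∧ ((r w ∧ w = v) ∨ (¬ r w ∧ v ∈ values M w)) := by
  simp only [nextRecords, Finset.mem_biUnion, mapNode]
  constructor
  · rintro ⟨u, hu, h⟩
    split_ifs at h with hr
    · simp at h
      obtain ⟨rfl, rfl⟩ := h
      exact ⟨hu, Or.inl ⟨hr, rfl⟩⟩
    · simp at h
      obtain ⟨h, rfl⟩ := h
      exact ⟨hu, Or.inr ⟨hr, h⟩⟩
  · rintro ⟨hw, ⟨hr, rfl⟩ | ⟨hr, h⟩⟩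
    · exact ⟨w, hw, by simp [hr]⟩
    · exact ⟨w, hw, by simp [hr, h]⟩

lemma currentNodes_nextRecords {M : Finset (Record V)} (hM : Represents G M) (r : V → Prop) :
    currentNodes (nextRecords M r) = (currentNodes M).filter fun u => ¬ r u := by
  ext u
  rw [mem_currentNodes, Finset.mem_filter]
  constructor
  · rintro ⟨⟨o, ho⟩, hu⟩
    rw [some_mem_nextRecords] at hu
    cases o with
    | none => exact none_mem_nextRecords.1 ho
    | some w =>
      obtain ⟨hw, ⟨hr, rfl⟩ | ⟨hr, h⟩⟩ := some_mem_nextRecords.1 ho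
      · exact absurd ⟨hw, Or.inl ⟨hr, rfl⟩⟩ hu
      · rw [hM w hw, Finset.mem_filter] at h
        exact ⟨h.1, fun hru => hu ⟨h.1, Or.inl ⟨hru, rfl⟩⟩⟩
  · rintro ⟨hu, hr⟩
    refine ⟨⟨none, none_mem_nextRecords.2 ⟨hu, hr⟩⟩, ?_⟩
    rw [some_mem_nextRecords]
    rintro ⟨_, ⟨h, _⟩ | ⟨_, h⟩⟩
    · exact hr h
    · rw [hM u hu] at h
      simp at h

lemma represents_nextRecords {M : Finset (Record V)} (hM : Represents G M) (r : V → Prop) :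
    Represents G (nextRecords M r) := by
  intro u hu
  rw [currentNodes_nextRecords hM] at hu ⊢
  rw [Finset.mem_filter] at hu
  ext w
  rw [mem_values, some_mem_nextRecords, Finset.mem_filter, Finset.mem_filter]
  constructor
  · rintro ⟨hw, ⟨hr, rfl⟩ | ⟨hr, h⟩⟩
    · exact absurd hr hu.2
    · rw [hM w hw, Finset.mem_filter] at h
      exact ⟨⟨hw, hr⟩, h.2.symm⟩
  · rintro ⟨⟨hw, hr⟩, h⟩
    refine ⟨hw, Or.inr ⟨hr, ?_⟩⟩
    rw [hM w hw, Finset.mem_filter]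
    exact ⟨hu.1, h.symm⟩

lemma Represents.recordDegree_eq {M : Finset (Record V)} (hM : Represents G M) {u : V}
    (hu : u ∈ currentNodes M) : recordDegree M u = inducedDegree G (currentNodes M) u := by
  rw [recordDegree, hM u hu]
  rfl

lemma Represents.recordDensity_eq {M : Finset (Record V)} (hM : Represents G M) :
    recordDensity M = density G (currentNodes M) := by
  rw [density_eq_sum_degree, recordDensity,
    Finset.sum_congr rfl fun u hu => by rw [hM.recordDegree_eq hu]]

lemma toPhaseState_mrPhase {σ : MRState V} (hσ : Represents G σ.records) (ω : ℝ × (V → ℕ)) :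
    (mrPhase ε δ θ σ ω).toPhaseState = directPhase ε δ θ G σ.toPhaseState ω := by
  have h := currentNodes_nextRecords hσ fun u =>
    IsRemoved (Fintype.card V) ε δ θ (currentNodes σ.records).card
      (recordDensity σ.records) ω.1 (ω.2 u)
  simp only [nextRecords, hσ.recordDensity_eq] at h
  simp only [MRState.toPhaseState, mrPhase, directPhase, h, hσ.recordDensity_eq]
  congr!

lemma measurable_mrPhase (σ : MRState V) : Measurable (mrPhase ε δ θ σ) :=
  measurable_of_isRemoved (Fintype.card V) (currentNodes σ.records).card
    (recordDensity σ.records) fun r =>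
      (⟨nextRecords σ.records r,
        σ.history ++ [(currentNodes σ.records, recordDensity σ.records)]⟩ : MRState V)

lemma measurable_directPhase (σ : PhaseState V) : Measurable (directPhase ε δ θ G σ) :=
  measurable_of_isRemoved (Fintype.card V) σ.current.card (density G σ.current) fun r =>
      (⟨σ.current.filter fun u => ¬ r u,
        σ.history ++ [(σ.current, density G σ.current)]⟩ : PhaseState V)

lemma phaseNoise_congr {S : Finset V} {deg deg' : V → ℕ} (h : ∀ u ∈ S, deg u = deg' u) :
    phaseNoise ε δ S deg = phaseNoise ε δ S deg' := by
  unfold phaseNoise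
  congr 2
  funext u
  split_ifs with hu
  · rw [h u hu]
  · rfl

lemma map_mrStepLaw {σ : MRState V} (hσ : Represents G σ.records) :
    (mrStepLaw ε δ θ σ).map MRState.toPhaseState = directStepLaw ε δ θ G σ.toPhaseState := by
  have hcur : σ.toPhaseState.current = currentNodes σ.records := rfl
  unfold mrStepLaw directStepLaw MRState.Halted
  rw [hcur]
  split_ifs with h
  · rw [Measure.map_dirac' measurable_from_top]
  · rw [Measure.map_map measurable_from_top (measurable_mrPhase σ),
      phaseNoise_congr fun u hu => hσ.recordDegree_eq hu]
    congr 1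
    funext ω
    exact toPhaseState_mrPhase hσ ω

lemma ae_represents (G : SimpleGraph V) (k : ℕ) :
    ∀ᵐ σ ∂(mrLaw ε δ θ G k), Represents G σ.records := by
  induction k with
  | zero =>
    rw [mrLaw, ae_dirac_iff (MeasurableSpace.measurableSet_top)]
    exact represents_initialRecords
  | succ k ih =>
    rw [ae_iff, mrLaw, Measure.bind_apply MeasurableSpace.measurableSet_top
      measurable_from_top.aemeasurable]
    refine (lintegral_congr_ae (g := fun _ => 0) ?_).trans lintegral_zero
    filter_upwards [ih] with σ hσ
    rw [mrStepLaw]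
    split_ifs with h
    · rw [Measure.dirac_apply' _ MeasurableSpace.measurableSet_top]
      simp [hσ]
    · rw [Measure.map_apply (measurable_mrPhase σ) MeasurableSpace.measurableSet_top]
      convert measure_empty (μ := phaseNoise ε δ (currentNodes σ.records) (recordDegree σ.records))
      rw [Set.eq_empty_iff_forall_notMem]
      intro ω hω
      exact hω (represents_nextRecords hσ _)

/-- The two algorithms are equivalent phase by phase. -/
theorem map_mrLaw (ε δ θ : ℝ) (G : SimpleGraph V) (k : ℕ) :
    (mrLaw ε δ θ G k).map MRState.toPhaseState = directLaw ε δ θ G k := by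
  induction k with
  | zero =>
    rw [mrLaw, directLaw, Measure.map_dirac' measurable_from_top, MRState.toPhaseState,
      currentNodes_initialRecords]
  | succ k ih =>
    ext A hA
    rw [directLaw, ← ih, Measure.map_apply measurable_from_top hA, mrLaw,
      Measure.bind_apply MeasurableSpace.measurableSet_top measurable_from_top.aemeasurable,
      Measure.bind_apply hA measurable_from_top.aemeasurable,
      lintegral_map measurable_from_top measurable_from_top]
    refine lintegral_congr_ae ?_
    filter_upwards [ae_represents G k] with σ hσ
    rw [← map_mrStepLaw hσ, Measure.map_apply measurable_from_top hA]

end MapReduce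

/-! ### Expectations along a run -/

section run

variable {V : Type*} [Fintype V] (ε δ θ : ℝ) (G : SimpleGraph V)

/-- The expectation of `g` at the state reached from a given state after `k` further passes of the
loop of the reference algorithm. -/
def runValue (g : PhaseState V → ℝ≥0∞) : ℕ → PhaseState V → ℝ≥0∞
  | 0, σ => g σ
  | k + 1, σ => ∫⁻ τ, runValue g k τ ∂(directStepLaw ε δ θ G σ)

variable {ε δ θ G}

lemma lintegral_directLaw (g : PhaseState V → ℝ≥0∞) (k : ℕ) :
    ∫⁻ σ, g σ ∂(directLaw ε δ θ G k) = runValue ε δ θ G g k ⟨Finset.univ, []⟩ := by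
  have h : ∀ k j, ∫⁻ σ, runValue ε δ θ G g k σ ∂(directLaw ε δ θ G j) =
      ∫⁻ σ, g σ ∂(directLaw ε δ θ G (j + k)) := by
    intro k
    induction k with
    | zero => intro j; rfl
    | succ k ih =>
      intro j
      rw [show j + (k + 1) = j + 1 + k by omega, ← ih, directLaw,
        Measure.lintegral_bind measurable_from_top.aemeasurable measurable_from_top.aemeasurable]
      rfl
  have h0 := h k 0
  rw [directLaw, lintegral_dirac' _ measurable_from_top, Nat.zero_add] at h0
  exact h0.symm

lemma lintegral_mrLaw (g : PhaseState V → ℝ≥0∞) (k : ℕ) :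
    ∫⁻ σ, g σ.toPhaseState ∂(mrLaw ε δ θ G k) = runValue ε δ θ G g k ⟨Finset.univ, []⟩ := by
  rw [← lintegral_directLaw, ← map_mrLaw, lintegral_map measurable_from_top measurable_from_top]

lemma runValue_of_current_eq_empty (g : PhaseState V → ℝ≥0∞) (k : ℕ) {σ : PhaseState V}
    (h : σ.current = ∅) : runValue ε δ θ G g k σ = g σ := by
  induction k with
  | zero => rfl
  | succ k ih =>
    rw [runValue, directStepLaw, if_pos h, lintegral_dirac' _ measurable_from_top, ih]

/-- The probability that a current node `u` survives a phase with noise `z`. -/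
def nodeSurvival (ε δ θ : ℝ) (G : SimpleGraph V) (S : Finset V) (z : ℝ) (u : V) : ℝ :=
  survivalProb (Fintype.card V) ε δ θ S.card (density G S) (inducedDegree G S u) z

/-- The expectation of `f` at the set surviving one phase. -/
def phaseMean (ε δ θ : ℝ) (G : SimpleGraph V) (S : Finset V) (f : Finset V → ℝ≥0∞) : ℝ≥0∞ :=
  ∫⁻ z, ENNReal.ofReal (laplaceDensity (noiseScale (Fintype.card V) ε S.card) z) *
    ∑ R ∈ S.powerset, ENNReal.ofReal (setWeight S (nodeSurvival ε δ θ G S z) R) * f R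

lemma runValue_succ (h : 0 < epsPrime ε δ) (g : PhaseState V → ℝ≥0∞) (k : ℕ) {S : Finset V}
    (hS : S.Nonempty) (l : List (Finset V × ℚ)) :
    runValue ε δ θ G g (k + 1) ⟨S, l⟩ =
      phaseMean ε δ θ G S fun R => runValue ε δ θ G g k ⟨R, l ++ [(S, density G S)]⟩ := by
  rw [runValue, directStepLaw, if_neg hS.ne_empty,
    lintegral_map measurable_from_top (measurable_directPhase _)]
  exact lintegral_phaseNoise h S (inducedDegree G S) (density G S)
    fun R => runValue ε δ θ G g k ⟨R, l ++ [(S, density G S)]⟩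

end run

/-! ### One phase shrinks the fourth moment of the size -/

section phaseMean

variable {V : Type*} [Fintype V] {ε δ θ : ℝ} {G : SimpleGraph V} {S : Finset V}

lemma noiseScale_pos {n s : ℕ} (hn : 2 ≤ n) (hε : 0 < ε) (hs : 0 < s) : 0 < noiseScale n ε s := by
  have h1 : 0 < Real.log n := Real.log_pos (by exact_mod_cast hn)
  have h2 : (0 : ℝ) < s := by exact_mod_cast hs
  unfold noiseScale
  positivity

lemma nodeSurvival_nonneg (h : 0 < epsPrime ε δ) (z : ℝ) (u : V) :
    0 ≤ nodeSurvival ε δ θ G S z u := survivalProb_nonneg h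

lemma nodeSurvival_le_one (h : 0 < epsPrime ε δ) (z : ℝ) (u : V) :
    nodeSurvival ε δ θ G S z u ≤ 1 := survivalProb_le_one h

lemma setWeight_nodeSurvival_nonneg (h : 0 < epsPrime ε δ) (z : ℝ) (R : Finset V) :
    0 ≤ setWeight S (nodeSurvival ε δ θ G S z) R :=
  setWeight_nonneg (fun u _ => nodeSurvival_nonneg h z u) fun u _ => nodeSurvival_le_one h z u

lemma measurable_setWeight (R : Finset V) :
    Measurable fun z => setWeight S (nodeSurvival ε δ θ G S z) R := by
  unfold setWeight
  refine Finset.measurable_fun_prod _ fun u _ => ?_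
  split_ifs
  · exact measurable_survivalProb
  · exact measurable_const.sub measurable_survivalProb

lemma measurable_sum_setWeight (f : Finset V → ℝ≥0∞) :
    Measurable fun z => ∑ R ∈ S.powerset,
      ENNReal.ofReal (setWeight S (nodeSurvival ε δ θ G S z) R) * f R :=
  Finset.measurable_fun_sum _ fun R _ =>
    (measurable_setWeight R).ennreal_ofReal.mul measurable_const

lemma sum_ofReal_setWeight_mul (h : 0 < epsPrime ε δ) (z : ℝ) {f : Finset V → ℝ}
    (hf : ∀ R, 0 ≤ f R) :
    ∑ R ∈ S.powerset, ENNReal.ofReal (setWeight S (nodeSurvival ε δ θ G S z) R) *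
        ENNReal.ofReal (f R) =
      ENNReal.ofReal (∑ R ∈ S.powerset, setWeight S (nodeSurvival ε δ θ G S z) R * f R) := by
  rw [ENNReal.ofReal_sum_of_nonneg fun R _ =>
    mul_nonneg (setWeight_nodeSurvival_nonneg h z R) (hf R)]
  exact Finset.sum_congr rfl fun R _ =>
    (ENNReal.ofReal_mul (setWeight_nodeSurvival_nonneg h z R)).symm

lemma phaseMean_mono {f g : Finset V → ℝ≥0∞} (hfg : ∀ R ⊆ S, f R ≤ g R) :
    phaseMean ε δ θ G S f ≤ phaseMean ε δ θ G S g := by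
  unfold phaseMean
  gcongr with z R hR
  exact hfg R (Finset.mem_powerset.1 hR)

lemma phaseMean_const_mul (c : ℝ≥0∞) (f : Finset V → ℝ≥0∞) :
    phaseMean ε δ θ G S (fun R => c * f R) = c * phaseMean ε δ θ G S f := by
  unfold phaseMean
  refine Eq.trans (lintegral_congr fun z => ?_) (lintegral_const_mul c
    ((measurable_laplaceDensity (noiseScale (Fintype.card V) ε S.card)).ennreal_ofReal.mul
      (measurable_sum_setWeight (ε := ε) (δ := δ) (θ := θ) (G := G) (S := S) f)))
  rw [mul_left_comm]
  congr 1
  rw [Finset.mul_sum]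
  exact Finset.sum_congr rfl fun R _ => mul_left_comm _ _ _

lemma phaseMean_one (hn : 2 ≤ Fintype.card V) (hε : 0 < ε) (h : 0 < epsPrime ε δ)
    (hS : S.Nonempty) : phaseMean ε δ θ G S (fun _ => 1) = 1 := by
  unfold phaseMean
  refine Eq.trans (lintegral_congr fun z => ?_)
    (lintegral_laplaceDensity (noiseScale_pos hn hε hS.card_pos))
  have := sum_ofReal_setWeight_mul (G := G) (S := S) (θ := θ) h z (f := fun _ => 1)
    fun _ => zero_le_one
  simp only [ENNReal.ofReal_one, mul_one, sum_setWeight] at this ⊢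
  rw [this, mul_one]

lemma survivalProb_le_exp (h : 0 < epsPrime ε δ) {n s d : ℕ} {ρ : ℚ} {z : ℝ} :
    survivalProb n ε δ θ s ρ d z ≤ Real.exp (-(trials n ε δ ρ z * removalProb ε δ d)) := by
  unfold survivalProb
  split_ifs
  · exact Real.exp_nonneg _
  · rw [← mul_neg, Real.exp_nat_mul]
    refine pow_le_pow_left₀ (by linarith [removalProb_lt_one h d]) ?_ _
    linarith [Real.add_one_le_exp (-removalProb ε δ d)]

/-- The bound `e^{1/e} n⁻⁴` on the probability that a node of low degree survives a phase. -/
def lowSurvival (n : ℕ) : ℝ := Real.exp (Real.exp (-1)) / n ^ 4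

/-- A node whose degree is at most `4 ρ̂` survives with probability `O(n⁻⁴)`: its expected number of
successes in `T_i` trials is at least `4 ln n`, and rounding `T_i` down costs less than one trial. -/
lemma survivalProb_le_lowSurvival (h : 0 < epsPrime ε δ) {n s d : ℕ} {ρ : ℚ} {z : ℝ}
    (hn : 0 < n) (hd : (d : ℝ) ≤ 4 * noisyDensity n ε ρ z) :
    survivalProb n ε δ θ s ρ d z ≤ lowSurvival n := by
  refine (survivalProb_le_exp h).trans ?_
  set p := removalProb ε δ d with hp
  have hp0 : 0 < p := removalProb_pos ε δ d
  have hp1 : p ≤ Real.exp (-1) := removalProb_le h d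
  have hn' : (0 : ℝ) < n := by exact_mod_cast hn
  have hT : 4 * Real.log n ≤ timeLimit n ε δ (noisyDensity n ε ρ z) * p := by
    have hq : Real.exp (-epsPrime ε δ * (4 * noisyDensity n ε ρ z + shift ε δ)) ≤ p := by
      rw [hp, removalProb]
      apply Real.exp_le_exp.2
      nlinarith
    unfold timeLimit
    rw [div_mul_eq_mul_div, le_div_iff₀ (Real.exp_pos _)]
    exact mul_le_mul_of_nonneg_left hq (by have := Real.log_natCast_nonneg n; linarith)
  have hfl : timeLimit n ε δ (noisyDensity n ε ρ z) ≤ trials n ε δ ρ z + 1 :=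
    (Nat.lt_floor_add_one _).le
  have hle : -(trials n ε δ ρ z * p) ≤ Real.exp (-1) - 4 * Real.log n := by nlinarith
  refine (Real.exp_le_exp.2 hle).trans (le_of_eq ?_)
  rw [Real.exp_sub, lowSurvival]
  congr 1
  rw [show (4 : ℝ) = ((4 : ℕ) : ℝ) by norm_num, Real.exp_nat_mul, Real.exp_log hn']

/-- By Markov's inequality at most half of the nodes have degree more than twice the average. -/
lemma card_high_degree (G : SimpleGraph V) (S : Finset V) {r : ℝ} (hr : (density G S : ℝ) ≤ r) :
    2 * (S.filter fun u => ¬ (inducedDegree G S u : ℝ) ≤ 4 * r).card ≤ S.card := by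
  set H := S.filter fun u => ¬ (inducedDegree G S u : ℝ) ≤ 4 * r with hH
  rcases S.eq_empty_or_nonempty with rfl | hS
  · simp [hH]
  have hs : (0 : ℝ) < S.card := by exact_mod_cast hS.card_pos
  have hsum : ∑ u ∈ S, (inducedDegree G S u : ℝ) = 2 * (density G S : ℝ) * S.card := by
    rw [← Nat.cast_sum, sum_inducedDegree, density_eq]
    push_cast
    field_simp
  have hρ : (0 : ℝ) ≤ density G S := by
    rw [density_eq]
    push_cast
    positivity
  by_contra! hlt
  have hlt' : (S.card : ℝ) < 2 * H.card := by exact_mod_cast hlt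
  have hHne : H.Nonempty := by
    rw [← Finset.card_pos]
    omega
  have h1 : ∑ _u ∈ H, 4 * (density G S : ℝ) < ∑ u ∈ H, (inducedDegree G S u : ℝ) := by
    refine Finset.sum_lt_sum_of_nonempty hHne fun u hu => ?_
    have := (Finset.mem_filter.1 hu).2
    linarith
  have h2 : ∑ u ∈ H, (inducedDegree G S u : ℝ) ≤ ∑ u ∈ S, (inducedDegree G S u : ℝ) :=
    Finset.sum_le_sum_of_subset_of_nonneg (Finset.filter_subset _ _) fun _ _ _ => Nat.cast_nonneg _
  rw [Finset.sum_const, nsmul_eq_mul] at h1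
  nlinarith

/-- If the noise does not push the density estimate below the true density, then only nodes of high
degree survive, up to an event of probability `|S| · O(n⁻⁴)`. -/
lemma sum_setWeight_card_pow_le (h : 0 < epsPrime ε δ) (hS : S.Nonempty) {z : ℝ}
    (hz : -(16 / ε * Real.log (Fintype.card V)) ≤ z) :
    ∑ R ∈ S.powerset, setWeight S (nodeSurvival ε δ θ G S z) R * (R.card : ℝ) ^ 4 ≤
      (S.card : ℝ) ^ 4 * (1 / 16 + S.card * lowSurvival (Fintype.card V)) := by
  have hn : 0 < Fintype.card V := hS.card_pos.trans_le (Finset.card_le_univ S)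
  set r := noisyDensity (Fintype.card V) ε (density G S) z with hr
  have hρ : (density G S : ℝ) ≤ r := by
    rw [hr, noisyDensity]
    linarith
  set L := S.filter fun u => (inducedDegree G S u : ℝ) ≤ 4 * r with hL
  set w := setWeight S (nodeSurvival ε δ θ G S z)
  have hw : ∀ R, 0 ≤ w R := setWeight_nodeSurvival_nonneg h z
  have hpt : ∀ R ∈ S.powerset, w R * (R.card : ℝ) ^ 4 ≤
      (S.card : ℝ) ^ 4 * (1 / 16 * w R + ∑ u ∈ L, if u ∈ R then w R else 0) := by
    intro R hR
    have hRS := Finset.mem_powerset.1 hR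
    by_cases hex : ∃ u ∈ L, u ∈ R
    · obtain ⟨u, huL, huR⟩ := hex
      have h1 : w R ≤ ∑ u ∈ L, if u ∈ R then w R else 0 := by
        have := Finset.single_le_sum (f := fun u => if u ∈ R then w R else 0)
          (fun v _ => by split_ifs <;> simp [hw]) huL
        simpa [huR] using this
      have h2 : (R.card : ℝ) ^ 4 ≤ (S.card : ℝ) ^ 4 := by
        gcongr
      calc w R * (R.card : ℝ) ^ 4 ≤ w R * (S.card : ℝ) ^ 4 := by
            gcongr
            exact hw R
        _ = (S.card : ℝ) ^ 4 * w R := mul_comm _ _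
        _ ≤ _ := by
            gcongr
            linarith [hw R]
    · push Not at hex
      have hsub : R ⊆ S.filter fun u => ¬ (inducedDegree G S u : ℝ) ≤ 4 * r := by
        intro u hu
        refine Finset.mem_filter.2 ⟨hRS hu, fun hle => ?_⟩
        exact hex u (Finset.mem_filter.2 ⟨hRS hu, hle⟩) hu
      have hcard : 2 * R.card ≤ S.card := by
        have := Finset.card_le_card hsub
        have := card_high_degree G S hρ
        omega
      have hcard' : (R.card : ℝ) ≤ S.card / 2 := by
        have : (2 : ℝ) * R.card ≤ S.card := by exact_mod_cast hcard
        linarith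
      have h0 : ∑ u ∈ L, (if u ∈ R then w R else 0) = 0 :=
        Finset.sum_eq_zero fun u hu => if_neg (hex u hu)
      rw [h0, add_zero]
      calc w R * (R.card : ℝ) ^ 4 ≤ w R * (S.card / 2 : ℝ) ^ 4 := by
            gcongr
            exact hw R
        _ = _ := by ring
  refine (Finset.sum_le_sum hpt).trans ?_
  rw [← Finset.mul_sum, Finset.sum_add_distrib, ← Finset.mul_sum, Finset.sum_comm]
  gcongr
  · rw [sum_setWeight, mul_one]
  · calc ∑ u ∈ L, ∑ R ∈ S.powerset, (if u ∈ R then w R else 0)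
        ≤ ∑ _u ∈ L, lowSurvival (Fintype.card V) := by
          refine Finset.sum_le_sum fun u hu => ?_
          have hu := Finset.mem_filter.1 hu
          rw [sum_setWeight_mem hu.1]
          exact survivalProb_le_lowSurvival h hn hu.2
      _ = L.card * lowSurvival (Fintype.card V) := by rw [Finset.sum_const, nsmul_eq_mul]
      _ ≤ S.card * lowSurvival (Fintype.card V) := by
          have : L.card ≤ S.card := Finset.card_filter_le _ _
          have : 0 ≤ lowSurvival (Fintype.card V) := by unfold lowSurvival; positivity
          gcongr

lemma sum_setWeight_card_pow_le' (h : 0 < epsPrime ε δ) (z : ℝ) :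
    ∑ R ∈ S.powerset, setWeight S (nodeSurvival ε δ θ G S z) R * (R.card : ℝ) ^ 4 ≤
      (S.card : ℝ) ^ 4 := by
  calc _ ≤ ∑ R ∈ S.powerset, setWeight S (nodeSurvival ε δ θ G S z) R * (S.card : ℝ) ^ 4 := by
        refine Finset.sum_le_sum fun R hR => ?_
        have := Finset.card_le_card (Finset.mem_powerset.1 hR)
        have := setWeight_nodeSurvival_nonneg (S := S) (G := G) (θ := θ) h z R
        gcongr
    _ = _ := by rw [← Finset.sum_mul, sum_setWeight, one_mul]

/-- The fourth moment of the size shrinks by this factor in a phase with `s` current nodes: halving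
contributes `1 / 16`, the other two terms bound the failure probabilities. -/
def shrinkFactor (n s : ℕ) : ℝ := 1 / 16 + s * lowSurvival n + Real.exp (-(4 * s))

lemma phaseMean_card_pow_le (hn : 2 ≤ Fintype.card V) (hε : 0 < ε) (h : 0 < epsPrime ε δ)
    (hS : S.Nonempty) :
    phaseMean ε δ θ G S (fun R => ENNReal.ofReal ((R.card : ℝ) ^ 4)) ≤
      ENNReal.ofReal ((S.card : ℝ) ^ 4 * shrinkFactor (Fintype.card V) S.card) := by
  set n := Fintype.card V
  set b := noiseScale n ε S.card with hb_def
  set a := 16 / ε * Real.log n with ha_def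
  have hlog : 0 < Real.log n := Real.log_pos (by exact_mod_cast hn)
  have hs : (0 : ℝ) < S.card := by exact_mod_cast hS.card_pos
  have hb : 0 < b := noiseScale_pos hn hε hS.card_pos
  have ha : 0 ≤ a := by positivity
  have hab : -a / b = -(4 * S.card) := by
    rw [ha_def, hb_def, noiseScale]
    field_simp
    norm_num
  have hA : 0 ≤ (S.card : ℝ) ^ 4 * (1 / 16 + S.card * lowSurvival n) := by
    unfold lowSurvival
    positivity
  have key : ∀ z, ENNReal.ofReal (laplaceDensity b z) *
      ∑ R ∈ S.powerset, ENNReal.ofReal (setWeight S (nodeSurvival ε δ θ G S z) R) *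
        ENNReal.ofReal ((R.card : ℝ) ^ 4) ≤
      ENNReal.ofReal ((S.card : ℝ) ^ 4 * (1 / 16 + S.card * lowSurvival n)) *
        ENNReal.ofReal (laplaceDensity b z) +
      ENNReal.ofReal ((S.card : ℝ) ^ 4) *
        (Set.Iio (-a)).indicator (fun z => ENNReal.ofReal (laplaceDensity b z)) z := by
    intro z
    rw [sum_ofReal_setWeight_mul h z fun R => by positivity]
    by_cases hz : z < -a
    · rw [Set.indicator_of_mem (by exact hz), mul_comm]
      refine le_add_of_nonneg_of_le (by positivity) ?_
      gcongr
      exact sum_setWeight_card_pow_le' h z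
    · rw [mul_comm]
      refine le_add_of_le_of_nonneg ?_ (by positivity)
      gcongr
      exact sum_setWeight_card_pow_le h hS (not_lt.1 hz)
  have hm : Measurable fun z => ENNReal.ofReal (laplaceDensity b z) :=
    (measurable_laplaceDensity b).ennreal_ofReal
  refine (lintegral_mono key).trans ?_
  rw [lintegral_add_left (hm.const_mul _), lintegral_const_mul _ hm,
    lintegral_const_mul _ (hm.indicator measurableSet_Iio), lintegral_laplaceDensity hb, mul_one,
    lintegral_indicator measurableSet_Iio]
  have htail := lintegral_laplaceDensity_tail hb ha
  rw [hab] at htail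
  refine (add_le_add_right (mul_le_mul_right htail _) _).trans (le_of_eq ?_)
  rw [← ENNReal.ofReal_mul (by positivity), ← ENNReal.ofReal_add hA (by positivity), shrinkFactor]
  congr 1
  ring

end phaseMean

/-! ### The number of phases -/

section termination

variable {V : Type*} [Fintype V] {ε δ θ : ℝ} {G : SimpleGraph V}

lemma exp_exp_neg_one_le : Real.exp (Real.exp (-1)) ≤ 1.45 := by
  have h1 : Real.exp (-1) ≤ 0.368 := by
    have := Real.exp_neg_one_lt_d9
    linarith
  have h2 : Real.exp 0.368 ≤ 1.45 := by
    have := Real.exp_bound' (x := 0.368) (by norm_num) (by norm_num) (n := 4) (by norm_num)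
    norm_num [Finset.sum_range_succ, Nat.factorial] at this
    linarith
  exact (Real.exp_le_exp.2 h1).trans h2

lemma shrinkFactor_le {n s : ℕ} (hs : s ≤ n) (hn : 0 < n) :
    shrinkFactor n s ≤ 1 / 16 + 1.45 / n ^ 3 + Real.exp (-(4 * s)) := by
  unfold shrinkFactor lowSurvival
  have hn' : (0 : ℝ) < n := by exact_mod_cast hn
  have h : (s : ℝ) * (Real.exp (Real.exp (-1)) / (n : ℝ) ^ 4) ≤ 1.45 / (n : ℝ) ^ 3 := by
    calc (s : ℝ) * (Real.exp (Real.exp (-1)) / (n : ℝ) ^ 4) ≤ n * (1.45 / (n : ℝ) ^ 4) := by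
          gcongr
          exact exp_exp_neg_one_le
      _ = 1.45 / (n : ℝ) ^ 3 := by field_simp
  linarith

lemma shrinkFactor_le_exp_neg_one {n s : ℕ} (hs : s ≤ n) (hn : 2 ≤ n) (hs1 : 1 ≤ s) :
    shrinkFactor n s ≤ Real.exp (-1) := by
  refine (shrinkFactor_le hs (by omega)).trans ?_
  have h1 : (1.45 : ℝ) / n ^ 3 ≤ 1.45 / 2 ^ 3 := by
    gcongr
    exact_mod_cast hn
  have h3 := Real.exp_neg_one_gt_d9
  have h2 : Real.exp (-(4 * s)) ≤ 0.02 := by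
    have hs1' : (1 : ℝ) ≤ s := by exact_mod_cast hs1
    calc Real.exp (-(4 * s)) ≤ Real.exp ((4 : ℕ) * (-1)) := by
          apply Real.exp_le_exp.2
          push_cast
          linarith
      _ = Real.exp (-1) ^ 4 := Real.exp_nat_mul _ _
      _ ≤ 0.368 ^ 4 := by
          have := Real.exp_neg_one_lt_d9
          gcongr
          linarith
      _ ≤ 0.02 := by norm_num
  norm_num at h1
  linarith

/-- The probability that a run has not stopped after `k` more passes decays like `e^{-k}`. -/
lemma runValue_not_halted_le (hn : 2 ≤ Fintype.card V) (hε : 0 < ε) (h : 0 < epsPrime ε δ)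
    (j k : ℕ) (S : Finset V) (l : List (Finset V × ℚ)) (hl : l.length + k ≤ j) :
    runValue ε δ θ G (fun σ => if σ.current = ∅ ∧ σ.history.length ≤ j then 0 else 1) k ⟨S, l⟩ ≤
      ENNReal.ofReal ((S.card : ℝ) ^ 4 * Real.exp (-1) ^ k) := by
  induction k generalizing S l with
  | zero =>
    rcases S.eq_empty_or_nonempty with rfl | hS
    · simp only [runValue]
      rw [if_pos ⟨trivial, by omega⟩]
      exact zero_le
    · simp only [runValue]
      rw [if_neg fun hc => hS.ne_empty hc.1]
      have : (1 : ℝ) ≤ S.card := by exact_mod_cast hS.card_pos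
      rw [← ENNReal.ofReal_one]
      apply ENNReal.ofReal_le_ofReal
      rw [pow_zero, mul_one]
      exact one_le_pow₀ this
  | succ k ih =>
    rcases S.eq_empty_or_nonempty with rfl | hS
    · rw [runValue_of_current_eq_empty _ _ rfl, if_pos ⟨rfl, by simp only; omega⟩]
      exact zero_le
    · rw [runValue_succ h _ _ hS]
      calc _ ≤ phaseMean ε δ θ G S (fun R => ENNReal.ofReal (Real.exp (-1) ^ k) *
            ENNReal.ofReal ((R.card : ℝ) ^ 4)) := by
            refine phaseMean_mono fun R _ => ?_
            refine (ih R _ (by simp; omega)).trans (le_of_eq ?_)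
            rw [mul_comm, ENNReal.ofReal_mul (by positivity)]
        _ = ENNReal.ofReal (Real.exp (-1) ^ k) *
            phaseMean ε δ θ G S (fun R => ENNReal.ofReal ((R.card : ℝ) ^ 4)) :=
            phaseMean_const_mul _ _
        _ ≤ ENNReal.ofReal (Real.exp (-1) ^ k) *
            ENNReal.ofReal ((S.card : ℝ) ^ 4 * Real.exp (-1)) := by
            gcongr
            refine (phaseMean_card_pow_le hn hε h hS).trans (ENNReal.ofReal_le_ofReal ?_)
            gcongr
            exact shrinkFactor_le_exp_neg_one (Finset.card_le_univ S) hn hS.card_pos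
        _ = _ := by
            rw [← ENNReal.ofReal_mul (by positivity)]
            congr 1
            ring

instance isProbabilityMeasure_phaseNoise_of {S : Finset V} {deg : V → ℕ}
    [IsProbabilityMeasure (laplaceLaw (4 * Real.log (Fintype.card V) / (S.card * ε)))] :
    IsProbabilityMeasure (phaseNoise ε δ S deg) := by
  have inst : ∀ u, IsProbabilityMeasure
      (if u ∈ S then removalTimeLaw (removalProb ε δ (deg u)) else Measure.dirac 0) := by
    intro u
    split_ifs <;> infer_instance
  unfold phaseNoise
  infer_instance

lemma isProbabilityMeasure_mrLaw (hn : 2 ≤ Fintype.card V) (hε : 0 < ε) (k : ℕ) :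
    IsProbabilityMeasure (mrLaw ε δ θ G k) := by
  induction k with
  | zero =>
    rw [mrLaw]
    infer_instance
  | succ k ih =>
    refine ⟨?_⟩
    rw [mrLaw, Measure.bind_apply MeasurableSet.univ measurable_from_top.aemeasurable]
    have : ∀ σ : MRState V, mrStepLaw ε δ θ σ Set.univ = 1 := by
      intro σ
      rw [mrStepLaw]
      split_ifs with hσ
      · exact measure_univ
      · have hb := noiseScale_pos hn hε (Finset.nonempty_iff_ne_empty.2 hσ).card_pos
        have := isProbabilityMeasure_laplaceLaw hb
        rw [noiseScale] at this
        rw [Measure.map_apply (measurable_mrPhase σ) MeasurableSet.univ, Set.preimage_univ]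
        exact measure_univ
    simp [this]

/-- The loop ends after at most `8 ln n` phases, except with probability `n⁻²`. -/
theorem mrPhasesAtMost_ge (hn : 2 ≤ Fintype.card V) (hε : 0 < ε) (h : 0 < epsPrime ε δ)
    (G : SimpleGraph V) :
    ENNReal.ofReal (1 - 1 / (Fintype.card V : ℝ) ^ 2) ≤
      mrPhasesAtMost ε δ θ G (8 * Real.log (Fintype.card V)) := by
  set n := Fintype.card V
  have hn' : (2 : ℝ) ≤ n := by exact_mod_cast hn
  have hlog : 0 < Real.log n := Real.log_pos (by linarith)
  set k := ⌊8 * Real.log n⌋₊ with hk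
  have hk1 : (k : ℝ) ≤ 8 * Real.log n := Nat.floor_le (by positivity)
  have hk2 : 8 * Real.log n < k + 1 := Nat.lt_floor_add_one _
  have := isProbabilityMeasure_mrLaw (G := G) (δ := δ) (θ := θ) hn hε k
  set E : Set (MRState V) := {σ | σ.Halted ∧ (σ.history.length : ℝ) ≤ 8 * Real.log n}
  have hE : mrLaw ε δ θ G k Eᶜ ≤ ENNReal.ofReal (1 / (n : ℝ) ^ 2) := by
    have h1 := runValue_not_halted_le (θ := θ) (G := G) hn hε h k k Finset.univ [] (by simp)
    rw [← lintegral_mrLaw] at h1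
    rw [← lintegral_indicator_one MeasurableSpace.measurableSet_top]
    refine (lintegral_mono fun σ => ?_).trans (h1.trans (ENNReal.ofReal_le_ofReal ?_))
    · by_cases hc : σ.toPhaseState.current = ∅ ∧ σ.toPhaseState.history.length ≤ k
      · rw [Set.indicator_of_notMem]
        · exact zero_le
        · refine fun hσ => hσ ⟨hc.1, le_trans ?_ hk1⟩
          exact_mod_cast hc.2
      · rw [if_neg hc]
        exact Set.indicator_le_self' (fun _ _ => zero_le) σ
    · rw [Finset.card_univ]
      have he : Real.exp (-1) ^ k ≤ Real.exp 1 / (n : ℝ) ^ 8 := by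
        rw [← Real.exp_nat_mul]
        calc Real.exp (k * -1) ≤ Real.exp (1 - (8 : ℕ) * Real.log n) := by
              apply Real.exp_le_exp.2
              push_cast
              linarith
          _ = _ := by rw [Real.exp_sub, Real.exp_nat_mul, Real.exp_log (by linarith)]
      calc (n : ℝ) ^ 4 * Real.exp (-1) ^ k ≤ (n : ℝ) ^ 4 * (Real.exp 1 / (n : ℝ) ^ 8) := by gcongr
        _ ≤ (n : ℝ) ^ 4 * ((n : ℝ) ^ 2 / (n : ℝ) ^ 8) := by
            gcongr
            have := Real.exp_one_lt_d9
            nlinarith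
        _ = 1 / (n : ℝ) ^ 2 := by field_simp
  refine le_trans ?_ (le_iSup (fun k => mrLaw ε δ θ G k E) k)
  rw [← compl_compl E, prob_compl_eq_one_sub MeasurableSpace.measurableSet_top,
    ENNReal.ofReal_sub _ (by positivity), ENNReal.ofReal_one]
  exact tsub_le_tsub_left hE 1

end termination

/-! ### Graphs differing in one edge -/

section neighbours

variable {V : Type*} [Fintype V] {G G' : SimpleGraph V} {x y : V}

/-- What the privacy proof uses about two graphs that differ exactly in the edge `xy`. The last
field says that the edge counts of all sets move in the same direction. -/
structure EdgeClose (G G' : SimpleGraph V) (x y : V) : Prop where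
  ne : x ≠ y
  degree_eq : ∀ (S : Finset V) (u : V), u ≠ x → u ≠ y → inducedDegree G S u = inducedDegree G' S u
  degree_eq_of_not_mem : ∀ S : Finset V, ¬ (x ∈ S ∧ y ∈ S) → ∀ u ∈ S,
    inducedDegree G S u = inducedDegree G' S u
  degree_le : ∀ (S : Finset V) (u : V), inducedDegree G S u ≤ inducedDegree G' S u + 1
  degree_le' : ∀ (S : Finset V) (u : V), inducedDegree G' S u ≤ inducedDegree G S u + 1
  edgeCount_eq : ∀ S : Finset V, ¬ (x ∈ S ∧ y ∈ S) → edgeCount G S = edgeCount G' S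
  edgeCount_le :
    (∀ S, edgeCount G S ≤ edgeCount G' S ∧ edgeCount G' S ≤ edgeCount G S + 1) ∨
    (∀ S, edgeCount G' S ≤ edgeCount G S ∧ edgeCount G S ≤ edgeCount G' S + 1)

lemma EdgeClose.symm (h : EdgeClose G G' x y) : EdgeClose G' G x y where
  ne := h.ne
  degree_eq S u hx hy := (h.degree_eq S u hx hy).symm
  degree_eq_of_not_mem S hS u hu := (h.degree_eq_of_not_mem S hS u hu).symm
  degree_le := h.degree_le'
  degree_le' := h.degree_le
  edgeCount_eq S hS := (h.edgeCount_eq S hS).symm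
  edgeCount_le := h.edgeCount_le.symm

lemma EdgeClose.of_insert (hxy : x ≠ y) (hnot : ¬ G.Adj x y)
    (h : ∀ u v, G'.Adj u v ↔ G.Adj u v ∨ s(u, v) = s(x, y)) : EdgeClose G G' x y := by
  have hE : G'.edgeFinset = insert s(x, y) G.edgeFinset := by
    ext e
    induction e with
    | _ a b =>
      rw [SimpleGraph.mem_edgeFinset, SimpleGraph.mem_edgeSet, h, Finset.mem_insert,
        SimpleGraph.mem_edgeFinset, SimpleGraph.mem_edgeSet, or_comm]
  have hnotin : s(x, y) ∉ G.edgeFinset := by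
    rwa [SimpleGraph.mem_edgeFinset, SimpleGraph.mem_edgeSet]
  have hcount : ∀ S, edgeCount G' S = edgeCount G S + if x ∈ S ∧ y ∈ S then 1 else 0 := by
    intro S
    unfold edgeCount
    rw [hE, Finset.filter_insert]
    by_cases hS : x ∈ S ∧ y ∈ S
    · rw [if_pos (by simpa using hS), if_pos hS, Finset.card_insert_of_notMem]
      exact fun hc => hnotin (Finset.mem_filter.1 hc).1
    · rw [if_neg (by simpa using hS), if_neg hS, add_zero]
  refine ⟨hxy, ?_, ?_, ?_, ?_, ?_, Or.inl fun S => ?_⟩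
  · intro S u hux huy
    unfold inducedDegree
    congr 1
    refine Finset.filter_congr fun v _ => ?_
    rw [h]
    simp [hux, huy]
  · intro S hS u hu
    unfold inducedDegree
    congr 1
    refine Finset.filter_congr fun v hv => ?_
    rw [h, Sym2.eq_iff]
    constructor
    · exact Or.inl
    · rintro (h1 | ⟨rfl, rfl⟩ | ⟨rfl, rfl⟩)
      · exact h1
      · exact absurd ⟨hu, hv⟩ hS
      · exact absurd ⟨hv, hu⟩ hS
  · intro S u
    refine le_trans ?_ (Nat.le_succ _)
    refine Finset.card_le_card fun v hv => ?_
    rw [Finset.mem_filter] at hv ⊢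
    exact ⟨hv.1, (h u v).2 (Or.inl hv.2)⟩
  · intro S u
    refine le_trans (Finset.card_le_card (t := insert (if u = x then y else x)
      (S.filter fun v => G.Adj u v)) fun v hv => ?_) (Finset.card_insert_le _ _)
    rw [Finset.mem_filter, h, Sym2.eq_iff] at hv
    rw [Finset.mem_insert, Finset.mem_filter]
    obtain ⟨hv, h1 | ⟨rfl, rfl⟩ | ⟨rfl, rfl⟩⟩ := hv
    · exact Or.inr ⟨hv, h1⟩
    · simp
    · simp [hxy.symm]
  · intro S hS
    rw [hcount, if_neg hS, add_zero]
  · rw [hcount]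
    split_ifs <;> omega

lemma Neighboring.edgeClose (h : Neighboring G G') : ∃ x y, EdgeClose G G' x y := by
  obtain ⟨e, he⟩ := h
  induction e with
  | _ x y =>
    have hmem : ∀ u v, (G.Adj u v ∧ ¬ G'.Adj u v ∨ G'.Adj u v ∧ ¬ G.Adj u v) ↔
        s(u, v) = s(x, y) := by
      intro u v
      have := Set.ext_iff.1 he s(u, v)
      rwa [Set.mem_symmDiff, SimpleGraph.mem_edgeSet, SimpleGraph.mem_edgeSet,
        Set.mem_singleton_iff] at this
    have hcongr : ∀ (H : SimpleGraph V) u v, s(u, v) = s(x, y) → (H.Adj u v ↔ H.Adj x y) := by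
      intro H u v huv
      rw [← SimpleGraph.mem_edgeSet, huv, SimpleGraph.mem_edgeSet]
    refine ⟨x, y, ?_⟩
    rcases (hmem x y).2 rfl with ⟨h1, h2⟩ | ⟨h1, h2⟩
    · refine (EdgeClose.of_insert h1.ne h2 fun u v => ?_).symm
      have := hmem u v
      have := hcongr G u v
      have := hcongr G' u v
      tauto
    · refine EdgeClose.of_insert h1.ne h2 fun u v => ?_
      have := hmem u v
      have := hcongr G u v
      have := hcongr G' u v
      tauto

lemma EdgeClose.density_eq (h : EdgeClose G G' x y) {S : Finset V} (hS : ¬ (x ∈ S ∧ y ∈ S)) :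
    density G S = density G' S := by
  rw [DenseDP.density_eq, DenseDP.density_eq, h.edgeCount_eq S hS]

lemma density_le_of_edgeCount_le {S : Finset V} {c : ℕ}
    (h : edgeCount G S ≤ edgeCount G' S + c) :
    (density G S : ℝ) ≤ density G' S + c / S.card := by
  rw [density_eq, density_eq]
  push_cast
  rw [← add_div]
  have : (edgeCount G S : ℝ) ≤ edgeCount G' S + c := by exact_mod_cast h
  gcongr

lemma EdgeClose.abs_density_sub_le (h : EdgeClose G G' x y) (S : Finset V) :
    |(density G S : ℝ) - density G' S| ≤ 1 / S.card := by
  have h1 : edgeCount G S ≤ edgeCount G' S + 1 ∧ edgeCount G' S ≤ edgeCount G S + 1 := by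
    rcases h.edgeCount_le with h | h <;> have := h S <;> omega
  have h2 := density_le_of_edgeCount_le h1.1
  have h3 := density_le_of_edgeCount_le h1.2
  push_cast at h2 h3
  rw [abs_le]
  constructor <;> linarith

lemma EdgeClose.density_le_half (h : EdgeClose G G' x y) (S : Finset V) :
    (density G S : ℝ) ≤ density G' S + 1 / 2 := by
  by_cases hS : x ∈ S ∧ y ∈ S
  · have h1 := (abs_le.1 (h.abs_density_sub_le S)).2
    have h2 : 2 ≤ S.card := Finset.one_lt_card.2 ⟨x, hS.1, y, hS.2, h.ne⟩
    have h3 : (1 : ℝ) / S.card ≤ 1 / 2 := by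
      gcongr
      exact_mod_cast h2
    linarith
  · rw [h.density_eq hS]
    linarith

end neighbours

/-! ### The final selection -/

section selection

variable {V : Type*} [Fintype V] {G G' : SimpleGraph V} {x y : V} {ε : ℝ}

/-- The candidates belonging to a list of visited sets. -/
def trajectory (G : SimpleGraph V) (L : List (Finset V)) : List (Finset V × ℚ) :=
  L.map fun S => (S, density G S)

lemma trajectory_append_singleton (L : List (Finset V)) (S : Finset V) :
    trajectory G L ++ [(S, density G S)] = trajectory G (L ++ [S]) := by
  simp [trajectory]

lemma selectLaw_apply {V : Type*} (ε : ℝ) (l : List (Finset V × ℚ)) (A : Set (Finset V)) :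
    selectLaw ε l A = ∑ p ∈ l.toFinset,
      ENNReal.ofReal (Real.exp (ε * p.2 / 2) / ∑ q ∈ l.toFinset, Real.exp (ε * q.2 / 2)) *
        A.indicator 1 p.1 := by
  let : MeasurableSpace (Finset V) := ⊤
  unfold selectLaw
  rw [Measure.finsetSum_apply]
  refine Finset.sum_congr rfl fun p _ => ?_
  rw [Measure.smul_apply, smul_eq_mul, Measure.dirac_apply' _ MeasurableSpace.measurableSet_top]

lemma selectLaw_le_one {V : Type*} (ε : ℝ) (l : List (Finset V × ℚ)) (A : Set (Finset V)) :
    selectLaw ε l A ≤ 1 := by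
  rw [selectLaw_apply]
  calc _ ≤ ∑ p ∈ l.toFinset, ENNReal.ofReal
        (Real.exp (ε * p.2 / 2) / ∑ q ∈ l.toFinset, Real.exp (ε * q.2 / 2)) := by
        refine Finset.sum_le_sum fun p _ => mul_le_of_le_one_right' ?_
        exact Set.indicator_le_self' (fun _ _ => zero_le) _
    _ = ENNReal.ofReal (∑ p ∈ l.toFinset,
        Real.exp (ε * p.2 / 2) / ∑ q ∈ l.toFinset, Real.exp (ε * q.2 / 2)) :=
        (ENNReal.ofReal_sum_of_nonneg fun p _ => by positivity).symm
    _ ≤ 1 := by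
        rw [← Finset.sum_div, ← ENNReal.ofReal_one]
        exact ENNReal.ofReal_le_ofReal (div_self_le_one _)

lemma selectLaw_trajectory (L : List (Finset V)) (A : Set (Finset V)) :
    selectLaw ε (trajectory G L) A = ∑ S ∈ L.toFinset,
      ENNReal.ofReal (Real.exp (ε * density G S / 2) /
        ∑ T ∈ L.toFinset, Real.exp (ε * density G T / 2)) * A.indicator 1 S := by
  have hinj : Function.Injective fun S : Finset V => (S, density G S) := fun S T h =>
    congrArg Prod.fst h
  have himg : (trajectory G L).toFinset = L.toFinset.image fun S => (S, density G S) := by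
    ext p
    simp [trajectory]
  rw [selectLaw_apply, himg, Finset.sum_image hinj.injOn]
  refine Finset.sum_congr rfl fun S _ => ?_
  rw [Finset.sum_image hinj.injOn]

/-- All weights move in the same direction, by a factor of at most `e^{ε/4}`. Hence either the
weight of the selected set or the normalizing sum contributes to the ratio, but not both. -/
lemma EdgeClose.selectLaw_le (h : EdgeClose G G' x y) (hε : 0 < ε) (L : List (Finset V))
    (A : Set (Finset V)) :
    selectLaw ε (trajectory G L) A ≤
      ENNReal.ofReal (Real.exp (ε / 4)) * selectLaw ε (trajectory G' L) A := by
  have key : ∀ S ∈ L.toFinset, Real.exp (ε * density G S / 2) /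
      ∑ T ∈ L.toFinset, Real.exp (ε * density G T / 2) ≤ Real.exp (ε / 4) *
        (Real.exp (ε * density G' S / 2) / ∑ T ∈ L.toFinset, Real.exp (ε * density G' T / 2)) := by
    intro S hS
    have hpos : ∀ H : SimpleGraph V, 0 < ∑ T ∈ L.toFinset, Real.exp (ε * density H T / 2) :=
      fun H => Finset.sum_pos (fun T _ => Real.exp_pos _) ⟨S, hS⟩
    have hhalf : ∀ {H H' : SimpleGraph V}, EdgeClose H H' x y → ∀ T,
        Real.exp (ε * density H T / 2) ≤ Real.exp (ε / 4) * Real.exp (ε * density H' T / 2) := by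
      intro H H' hH T
      rw [← Real.exp_add]
      apply Real.exp_le_exp.2
      have := hH.density_le_half T
      nlinarith
    have hmono : ∀ {H H' : SimpleGraph V}, (∀ T, edgeCount H T ≤ edgeCount H' T) → ∀ T,
        Real.exp (ε * density H T / 2) ≤ Real.exp (ε * density H' T / 2) := by
      intro H H' hH T
      apply Real.exp_le_exp.2
      have := density_le_of_edgeCount_le (c := 0) (hH T)
      simp only [Nat.cast_zero, zero_div, add_zero] at this
      gcongr
    rw [← mul_div_assoc, div_le_div_iff₀ (hpos G) (hpos G')]
    rcases h.edgeCount_le with hle | hle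
    · calc _ ≤ Real.exp (ε * density G' S / 2) *
            ∑ T ∈ L.toFinset, Real.exp (ε / 4) * Real.exp (ε * density G T / 2) := by
            exact mul_le_mul (hmono (fun T => (hle T).1) S)
              (Finset.sum_le_sum fun T _ => hhalf h.symm T) (hpos G').le (Real.exp_nonneg _)
        _ = _ := by
            rw [← Finset.mul_sum]
            ring
    · exact mul_le_mul (hhalf h S) (Finset.sum_le_sum fun T _ => hmono (fun T => (hle T).1) T)
        (hpos G').le (by positivity)
  rw [selectLaw_trajectory, selectLaw_trajectory, Finset.mul_sum]
  refine Finset.sum_le_sum fun S hS => ?_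
  rw [← mul_assoc, ← ENNReal.ofReal_mul (Real.exp_nonneg _)]
  gcongr
  exact key S hS

/-- The probability of selecting an element of `A` if the run has stopped, and `0` otherwise. -/
def outputValue {V : Type*} (ε : ℝ) (A : Set (Finset V)) (σ : PhaseState V) : ℝ≥0∞ :=
  if σ.current = ∅ then selectLaw ε σ.history A else 0

lemma outputValue_le_one {V : Type*} {ε : ℝ} (A : Set (Finset V)) (σ : PhaseState V) :
    outputValue ε A σ ≤ 1 := by
  unfold outputValue
  split_ifs
  · exact selectLaw_le_one _ _ _
  · exact zero_le

end selection

section run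

variable {V : Type*} [Fintype V] {ε δ θ : ℝ} {G G' : SimpleGraph V} {x y : V}

lemma runValue_le_one (hn : 2 ≤ Fintype.card V) (hε : 0 < ε) (h : 0 < epsPrime ε δ)
    {g : PhaseState V → ℝ≥0∞} (hg : ∀ σ, g σ ≤ 1) (k : ℕ) (σ : PhaseState V) :
    runValue ε δ θ G g k σ ≤ 1 := by
  induction k generalizing σ with
  | zero => exact hg σ
  | succ k ih =>
    obtain ⟨S, l⟩ := σ
    rcases S.eq_empty_or_nonempty with rfl | hS
    · rw [runValue_of_current_eq_empty _ _ rfl]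
      exact hg _
    · rw [runValue_succ h _ _ hS, ← phaseMean_one (θ := θ) (G := G) hn hε h hS]
      exact phaseMean_mono fun R _ => ih _

/-- Once one endpoint of the differing edge is gone, both runs have the same law and only the final
selection still sees the difference. -/
lemma EdgeClose.runValue_le_of_not_mem (hc : EdgeClose G G' x y) (hε : 0 < ε)
    (h : 0 < epsPrime ε δ) (A : Set (Finset V)) (k : ℕ) (S : Finset V) (L : List (Finset V))
    (hS : ¬ (x ∈ S ∧ y ∈ S)) :
    runValue ε δ θ G (outputValue ε A) k ⟨S, trajectory G L⟩ ≤ ENNReal.ofReal (Real.exp (ε / 4)) *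
      runValue ε δ θ G' (outputValue ε A) k ⟨S, trajectory G' L⟩ := by
  have hbase : ∀ S L, outputValue ε A ⟨S, trajectory G L⟩ ≤ ENNReal.ofReal (Real.exp (ε / 4)) *
      outputValue ε A ⟨S, trajectory G' L⟩ := by
    intro S L
    unfold outputValue
    dsimp only
    split_ifs
    · exact hc.selectLaw_le hε L A
    · exact zero_le
  induction k generalizing S L with
  | zero => exact hbase S L
  | succ k ih =>
    rcases S.eq_empty_or_nonempty with rfl | hne
    · rw [runValue_of_current_eq_empty _ _ rfl, runValue_of_current_eq_empty _ _ rfl]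
      exact hbase ∅ L
    · rw [runValue_succ h _ _ hne, runValue_succ h _ _ hne, ← phaseMean_const_mul]
      have hstep : ∀ f, phaseMean ε δ θ G S f = phaseMean ε δ θ G' S f := by
        intro f
        have hw : ∀ z R, setWeight S (nodeSurvival ε δ θ G S z) R =
            setWeight S (nodeSurvival ε δ θ G' S z) R := by
          refine fun z R => setWeight_congr fun u hu => ?_
          unfold nodeSurvival
          rw [hc.density_eq hS, hc.degree_eq_of_not_mem S hS u hu]
        unfold phaseMean
        simp only [hw]
      rw [hstep, trajectory_append_singleton, trajectory_append_singleton]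
      exact phaseMean_mono fun R hR => ih R _ fun hxy => hS ⟨hR hxy.1, hR hxy.2⟩

end run

/-! ### Likelihood ratios of one phase -/

/-- The privacy cost of surviving, per expected success: `(e^{ε'} - 1) / (1 - e⁻¹)`. -/
def survivalCost (ε δ : ℝ) : ℝ := (Real.exp (epsPrime ε δ) - 1) / (1 - Real.exp (-1))

lemma survivalCost_nonneg {ε δ : ℝ} (h : 0 < epsPrime ε δ) : 0 ≤ survivalCost ε δ :=
  div_nonneg (by linarith [Real.add_one_le_exp (epsPrime ε δ)])
    (by linarith [exp_neg_one_lt_one])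

lemma removalProb_le_mul {ε δ : ℝ} (h : 0 < epsPrime ε δ) {d d' : ℕ} (hd : d' ≤ d + 1) :
    removalProb ε δ d ≤ Real.exp (epsPrime ε δ) * removalProb ε δ d' := by
  have hd : (d' : ℝ) ≤ d + 1 := by exact_mod_cast hd
  unfold removalProb
  rw [← Real.exp_add]
  apply Real.exp_le_exp.2
  nlinarith

lemma one_sub_removalProb_pow_le {ε δ : ℝ} (h : 0 < epsPrime ε δ) {d d' : ℕ} (hd : d ≤ d' + 1)
    (N : ℕ) :
    (1 - removalProb ε δ d) ^ N ≤
      Real.exp (survivalCost ε δ * (N * removalProb ε δ d)) * (1 - removalProb ε δ d') ^ N := by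
  have hp := removalProb_pos ε δ d
  have hp1 := removalProb_lt_one h d
  have hp' := removalProb_le h d'
  have he := exp_neg_one_lt_one
  have hle := removalProb_le_mul h hd
  have hκ : (Real.exp (epsPrime ε δ) - 1) = survivalCost ε δ * (1 - Real.exp (-1)) := by
    rw [survivalCost, div_mul_cancel₀]
    linarith
  have hκ0 := survivalCost_nonneg h
  set p := removalProb ε δ d
  set p' := removalProb ε δ d'
  set κ := survivalCost ε δ
  rw [show κ * (N * p) = N * (κ * p) by ring, Real.exp_nat_mul, ← mul_pow]
  refine pow_le_pow_left₀ (by linarith) ?_ N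
  calc 1 - p ≤ (1 - p') + κ * (1 - Real.exp (-1)) * p := by
        rw [← hκ]
        linarith
    _ ≤ (1 - p') + κ * (1 - p') * p := by gcongr
    _ = (κ * p + 1) * (1 - p') := by ring
    _ ≤ Real.exp (κ * p) * (1 - p') := by
        gcongr
        · linarith
        · exact Real.add_one_le_exp _

lemma one_sub_one_sub_pow_le {p p' a : ℝ} (hp1 : p ≤ 1) (hp0' : 0 ≤ p')
    (hp1' : p' ≤ 1) (ha : 1 ≤ a) (hle : p ≤ a * p') (N : ℕ) :
    1 - (1 - p) ^ N ≤ a * (1 - (1 - p') ^ N) := by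
  have hgeom : ∀ q : ℝ, 1 - (1 - q) ^ N = q * ∑ i ∈ Finset.range N, (1 - q) ^ i := by
    intro q
    have := geom_sum_mul (1 - q) N
    linarith
  rcases le_total p p' with hpp | hpp
  · have h1 : (1 - p') ^ N ≤ (1 - p) ^ N := pow_le_pow_left₀ (by linarith) (by linarith) N
    have h2 : (1 - p') ^ N ≤ 1 := pow_le_one₀ (by linarith) (by linarith)
    nlinarith
  · rw [hgeom, hgeom, ← mul_assoc]
    refine mul_le_mul hle (Finset.sum_le_sum fun i _ => ?_)
      (Finset.sum_nonneg fun i _ => pow_nonneg (by linarith) i) (by positivity)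
    exact pow_le_pow_left₀ (by linarith) (by linarith) i

section ratios

variable {V : Type*} [Fintype V] {ε δ θ : ℝ} {G G' : SimpleGraph V} {x y : V} {S R : Finset V}

/-- The expected number of successes of a node in the trials of a phase with noise `z`. -/
def hazard (ε δ : ℝ) (G : SimpleGraph V) (S : Finset V) (z : ℝ) (u : V) : ℝ :=
  trials (Fintype.card V) ε δ (density G S) z * removalProb ε δ (inducedDegree G S u)

lemma nodeSurvival_le_exp (h : 0 < epsPrime ε δ) (z : ℝ) (u : V) :
    nodeSurvival ε δ θ G S z u ≤ Real.exp (-hazard ε δ G S z u) := survivalProb_le_exp h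

/-- The log-likelihood ratio that the outcome for an endpoint of the differing edge may cost. -/
def outcomeCost (ε δ : ℝ) (G : SimpleGraph V) (S : Finset V) (z : ℝ) (R : Finset V) (u : V) : ℝ :=
  if u ∈ R then survivalCost ε δ * hazard ε δ G S z u else epsPrime ε δ

/-- The two noise values give the same noisy density, hence the same number of trials. -/
lemma EdgeClose.factor_le (hc : EdgeClose G G' x y) (h : 0 < epsPrime ε δ) {z z' : ℝ}
    (hz : (density G S : ℝ) + z = density G' S + z') (u : V) :
    (if u ∈ R then nodeSurvival ε δ θ G S z u else 1 - nodeSurvival ε δ θ G S z u) ≤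
      Real.exp (outcomeCost ε δ G S z R u) *
        if u ∈ R then nodeSurvival ε δ θ G' S z' u else 1 - nodeSurvival ε δ θ G' S z' u := by
  have htr : trials (Fintype.card V) ε δ (density G' S) z' =
      trials (Fintype.card V) ε δ (density G S) z := by
    unfold trials noisyDensity
    congr 2
    linarith
  have h1 : 1 ≤ Real.exp (epsPrime ε δ) := Real.one_le_exp h.le
  unfold nodeSurvival survivalProb outcomeCost hazard
  rw [htr]
  split_ifs
  · simp
  · exact one_sub_removalProb_pow_le h (hc.degree_le S u) _
  · simpa using h1
  · exact one_sub_one_sub_pow_le (removalProb_lt_one h _).le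
      (removalProb_pos _ _ _).le (removalProb_lt_one h _).le h1
      (removalProb_le_mul h (hc.degree_le' S u)) _

lemma EdgeClose.setWeight_le (hc : EdgeClose G G' x y) (h : 0 < epsPrime ε δ) {z z' : ℝ}
    (hz : (density G S : ℝ) + z = density G' S + z') (hx : x ∈ S) (hy : y ∈ S) (R : Finset V) :
    setWeight S (nodeSurvival ε δ θ G S z) R ≤
      Real.exp (outcomeCost ε δ G S z R x + outcomeCost ε δ G S z R y) *
        setWeight S (nodeSurvival ε δ θ G' S z') R := by
  have hy' : y ∈ S.erase x := Finset.mem_erase.2 ⟨hc.ne.symm, hy⟩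
  have htr : trials (Fintype.card V) ε δ (density G' S) z' =
      trials (Fintype.card V) ε δ (density G S) z := by
    unfold trials noisyDensity
    congr 2
    linarith
  have hnn : ∀ (H : SimpleGraph V) (z : ℝ) (u : V), 0 ≤
      if u ∈ R then nodeSurvival ε δ θ H S z u else 1 - nodeSurvival ε δ θ H S z u := by
    intro H z u
    split_ifs
    · exact nodeSurvival_nonneg h z u
    · linarith [nodeSurvival_le_one (θ := θ) (G := H) (S := S) h z u]
  have hrest : ∏ u ∈ (S.erase x).erase y,
      (if u ∈ R then nodeSurvival ε δ θ G S z u else 1 - nodeSurvival ε δ θ G S z u) =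
      ∏ u ∈ (S.erase x).erase y,
      (if u ∈ R then nodeSurvival ε δ θ G' S z' u else 1 - nodeSurvival ε δ θ G' S z' u) := by
    refine Finset.prod_congr rfl fun u hu => ?_
    rw [Finset.mem_erase, Finset.mem_erase] at hu
    have : nodeSurvival ε δ θ G S z u = nodeSurvival ε δ θ G' S z' u := by
      unfold nodeSurvival survivalProb
      rw [htr, hc.degree_eq S u hu.2.1 hu.1]
    rw [this]
  have hfx := hc.factor_le (θ := θ) (R := R) h hz x
  have hfy := hc.factor_le (θ := θ) (R := R) h hz y
  have hprod : 0 ≤ ∏ u ∈ (S.erase x).erase y,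
      (if u ∈ R then nodeSurvival ε δ θ G' S z' u else 1 - nodeSurvival ε δ θ G' S z' u) :=
    Finset.prod_nonneg fun u _ => hnn G' z' u
  unfold setWeight
  rw [← Finset.mul_prod_erase S _ hx, ← Finset.mul_prod_erase (S.erase x) _ hy',
    ← Finset.mul_prod_erase S _ hx, ← Finset.mul_prod_erase (S.erase x) _ hy', hrest, Real.exp_add]
  calc _ ≤ (Real.exp (outcomeCost ε δ G S z R x) *
          if x ∈ R then nodeSurvival ε δ θ G' S z' x else 1 - nodeSurvival ε δ θ G' S z' x) *
        ((Real.exp (outcomeCost ε δ G S z R y) *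
          if y ∈ R then nodeSurvival ε δ θ G' S z' y else 1 - nodeSurvival ε δ θ G' S z' y) * _) :=
        mul_le_mul hfx (mul_le_mul_of_nonneg_right hfy hprod)
          (mul_nonneg (hnn G z y) hprod) (mul_nonneg (Real.exp_nonneg _) (hnn G' z' x))
    _ = _ := by ring

lemma EdgeClose.laplaceDensity_le (hc : EdgeClose G G' x y) (hn : 2 ≤ Fintype.card V) (hε : 0 < ε)
    (hS : S.Nonempty) (z : ℝ) :
    laplaceDensity (noiseScale (Fintype.card V) ε S.card) z ≤
      Real.exp (ε / (4 * Real.log (Fintype.card V))) *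
        laplaceDensity (noiseScale (Fintype.card V) ε S.card)
          (z + ((density G S : ℝ) - density G' S)) := by
  have hb := noiseScale_pos hn hε hS.card_pos
  refine (laplaceDensity_le_shift hb z ((density G S : ℝ) - density G' S)).trans ?_
  refine mul_le_mul_of_nonneg_right (Real.exp_le_exp.2 ?_) (laplaceDensity_nonneg hb _)
  have hs : (0 : ℝ) < S.card := by exact_mod_cast hS.card_pos
  have hlog : 0 < Real.log (Fintype.card V) := Real.log_pos (by exact_mod_cast hn)
  calc _ ≤ (1 / S.card : ℝ) / noiseScale (Fintype.card V) ε S.card := by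
        gcongr
        exact hc.abs_density_sub_le S
    _ = ε / (4 * Real.log (Fintype.card V)) := by
        unfold noiseScale
        field_simp

end ratios

/-! ### The privacy induction -/

section induction

variable {V : Type*} [Fintype V] {ε δ θ : ℝ} {G G' : SimpleGraph V} {x y : V} {S : Finset V}

/-- The log-likelihood ratio still available when the endpoints may survive further expected
successes `a` and `b`, through `m` more phases: Laplace noise, survival of both endpoints, removal
of both endpoints, and final selection. -/
def budget (n : ℕ) (ε δ : ℝ) (m : ℕ) (a b : ℝ) : ℝ :=
  m * (ε / (4 * Real.log n)) + survivalCost ε δ * (a + b) + 2 * epsPrime ε δ + ε / 4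

/-- The inequality for one outcome `R` of a phase, given the noise. If a budget is exhausted by
the outcome, the error term exceeds its probability. -/
lemma EdgeClose.outcome_le (hc : EdgeClose G G' x y) (hε : 0 < ε) (h : 0 < epsPrime ε δ)
    (hx : x ∈ S) (hy : y ∈ S) {F F' : Finset V → ℝ≥0∞} {Ψ : Finset V → ℝ} (hΨ : ∀ R, 0 ≤ Ψ R)
    {m : ℕ} {a b : ℝ} (ha : 0 ≤ a) (hb : 0 ≤ b) (hF : ∀ R, F R ≤ 1)
    (hboth : ∀ R ⊆ S, x ∈ R → y ∈ R → ∀ a b,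
      F R ≤ ENNReal.ofReal (Real.exp (budget (Fintype.card V) ε δ m a b)) * F' R +
        ENNReal.ofReal (Real.exp (-a) + Real.exp (-b) + Ψ R))
    (hnot : ∀ R ⊆ S, ¬ (x ∈ R ∧ y ∈ R) → F R ≤ ENNReal.ofReal (Real.exp (ε / 4)) * F' R)
    {z z' : ℝ} (hz : (density G S : ℝ) + z = density G' S + z') {R : Finset V} (hR : R ⊆ S) :
    ENNReal.ofReal (setWeight S (nodeSurvival ε δ θ G S z) R) * F R ≤
      ENNReal.ofReal (Real.exp (budget (Fintype.card V) ε δ m a b)) *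
        (ENNReal.ofReal (setWeight S (nodeSurvival ε δ θ G' S z') R) * F' R) +
      ENNReal.ofReal (
        (if x ∈ R then setWeight S (nodeSurvival ε δ θ G S z) R else 0) *
          Real.exp (-a + hazard ε δ G S z x) +
        (if y ∈ R then setWeight S (nodeSurvival ε δ θ G S z) R else 0) *
          Real.exp (-b + hazard ε δ G S z y) +
        setWeight S (nodeSurvival ε δ θ G S z) R * Ψ R) := by
  have hw0 := setWeight_nodeSurvival_nonneg (S := S) (G := G) (θ := θ) h z R
  have hw := hc.setWeight_le (θ := θ) h hz hx hy R
  set w := setWeight S (nodeSurvival ε δ θ G S z) R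
  set w' := setWeight S (nodeSurvival ε δ θ G' S z') R
  set n := Fintype.card V
  have hκ := survivalCost_nonneg h
  have hlog := Real.log_natCast_nonneg n
  have hwΨ := mul_nonneg hw0 (hΨ R)
  have hwx : 0 ≤ (if x ∈ R then w else 0) * Real.exp (-a + hazard ε δ G S z x) := by
    split_ifs <;> positivity
  have hwy : 0 ≤ (if y ∈ R then w else 0) * Real.exp (-b + hazard ε δ G S z y) := by
    split_ifs <;> positivity
  -- combining the ratio of the weights with the bound for the remaining run
  have hmul : ∀ {c : ℝ}, outcomeCost ε δ G S z R x + outcomeCost ε δ G S z R y + c ≤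
      budget n ε δ m a b → ENNReal.ofReal w * (ENNReal.ofReal (Real.exp c) * F' R) ≤
        ENNReal.ofReal (Real.exp (budget n ε δ m a b)) * (ENNReal.ofReal w' * F' R) := by
    intro c hcb
    rw [← mul_assoc, ← mul_assoc, ← ENNReal.ofReal_mul hw0, ← ENNReal.ofReal_mul (Real.exp_nonneg _)]
    refine mul_le_mul_left (ENNReal.ofReal_le_ofReal ?_) _
    have hw'0 := setWeight_nodeSurvival_nonneg (S := S) (G := G') (θ := θ) h z' R
    calc w * Real.exp c
        ≤ (Real.exp (outcomeCost ε δ G S z R x + outcomeCost ε δ G S z R y) * w') *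
          Real.exp c := by gcongr
      _ = Real.exp (outcomeCost ε δ G S z R x + outcomeCost ε δ G S z R y + c) * w' := by
          rw [Real.exp_add _ c]
          ring
      _ ≤ _ := by gcongr
  by_cases hRxy : x ∈ R ∧ y ∈ R
  · obtain ⟨hxR, hyR⟩ := hRxy
    have hF1 := hboth R hR hxR hyR (a - hazard ε δ G S z x) (b - hazard ε δ G S z y)
    refine (mul_le_mul_right hF1 (ENNReal.ofReal w)).trans ?_
    rw [mul_add]
    refine add_le_add (hmul (le_of_eq ?_)) ?_
    · simp only [outcomeCost, hxR, hyR, if_true, budget]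
      ring
    · rw [← ENNReal.ofReal_mul hw0, if_pos hxR, if_pos hyR]
      refine ENNReal.ofReal_le_ofReal (le_of_eq ?_)
      rw [neg_sub, neg_sub, sub_eq_neg_add, sub_eq_neg_add]
      ring
  have htriv : ∀ {t : ℝ}, 0 ≤ t → ENNReal.ofReal w * F R ≤ ENNReal.ofReal (w * Real.exp t) := by
    intro t ht
    calc ENNReal.ofReal w * F R ≤ ENNReal.ofReal w := mul_le_of_le_one_right' (hF R)
      _ ≤ _ := ENNReal.ofReal_le_ofReal (le_mul_of_one_le_right hw0 (Real.one_le_exp ht))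
  by_cases h1 : x ∈ R ∧ a < hazard ε δ G S z x
  · refine le_add_of_nonneg_of_le zero_le ((htriv (t := -a + hazard ε δ G S z x)
      (by linarith [h1.2])).trans (ENNReal.ofReal_le_ofReal ?_))
    rw [if_pos h1.1]
    linarith
  by_cases h2 : y ∈ R ∧ b < hazard ε δ G S z y
  · refine le_add_of_nonneg_of_le zero_le ((htriv (t := -b + hazard ε δ G S z y)
      (by linarith [h2.2])).trans (ENNReal.ofReal_le_ofReal ?_))
    rw [if_pos h2.1]
    linarith
  have hcost : ∀ {u : V} {t : ℝ}, 0 ≤ t → ¬ (u ∈ R ∧ t < hazard ε δ G S z u) →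
      outcomeCost ε δ G S z R u ≤ survivalCost ε δ * t + epsPrime ε δ := by
    intro u t ht hu
    unfold outcomeCost
    split_ifs with huR
    · have : hazard ε δ G S z u ≤ t := not_lt.1 fun hlt => hu ⟨huR, hlt⟩
      have := mul_le_mul_of_nonneg_left this hκ
      linarith
    · have := mul_nonneg hκ ht
      linarith
  refine le_add_of_le_of_nonneg ((mul_le_mul_right (hnot R hR hRxy) _).trans (hmul ?_)) zero_le
  have hm : 0 ≤ m * (ε / (4 * Real.log n)) := by positivity
  have := hcost ha h1
  have := hcost hb h2
  unfold budget
  linarith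

/-- One phase on the two graphs. The noise on `G'` is translated so that both phases see the same
noisy density; surviving expected `t` successes has probability at most `e^{-t}`, so that the error
terms do not grow. -/
lemma EdgeClose.phaseMean_le (hc : EdgeClose G G' x y) (hn : 2 ≤ Fintype.card V) (hε : 0 < ε)
    (h : 0 < epsPrime ε δ) (hx : x ∈ S) (hy : y ∈ S) {F F' : Finset V → ℝ≥0∞} {Ψ : Finset V → ℝ}
    (hΨ : ∀ R, 0 ≤ Ψ R) {m : ℕ} {a b : ℝ} (ha : 0 ≤ a) (hb : 0 ≤ b) (hF : ∀ R, F R ≤ 1)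
    (hboth : ∀ R ⊆ S, x ∈ R → y ∈ R → ∀ a b,
      F R ≤ ENNReal.ofReal (Real.exp (budget (Fintype.card V) ε δ m a b)) * F' R +
        ENNReal.ofReal (Real.exp (-a) + Real.exp (-b) + Ψ R))
    (hnot : ∀ R ⊆ S, ¬ (x ∈ R ∧ y ∈ R) → F R ≤ ENNReal.ofReal (Real.exp (ε / 4)) * F' R) :
    phaseMean ε δ θ G S F ≤
      ENNReal.ofReal (Real.exp (budget (Fintype.card V) ε δ (m + 1) a b)) *
        phaseMean ε δ θ G' S F' +
      (ENNReal.ofReal (Real.exp (-a) + Real.exp (-b)) +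
        phaseMean ε δ θ G S fun R => ENNReal.ofReal (Ψ R)) := by
  have hne : S.Nonempty := ⟨x, hx⟩
  set n := Fintype.card V
  set lap := laplaceDensity (noiseScale n ε S.card)
  have hlap0 : ∀ z, 0 ≤ lap z := laplaceDensity_nonneg (noiseScale_pos hn hε hne.card_pos)
  have hlapm : Measurable fun z => ENNReal.ofReal (lap z) :=
    (measurable_laplaceDensity _).ennreal_ofReal
  set Δ := (density G S : ℝ) - density G' S
  have hw0 := fun z R => setWeight_nodeSurvival_nonneg (S := S) (G := G) (θ := θ) h z R
  have hsurv : ∀ {u : V} (_ : u ∈ S) (t z : ℝ),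
      (∑ R ∈ S.powerset, if u ∈ R then setWeight S (nodeSurvival ε δ θ G S z) R else 0) *
        Real.exp (-t + hazard ε δ G S z u) ≤ Real.exp (-t) := by
    intro u hu t z
    rw [sum_setWeight_mem hu]
    calc _ ≤ Real.exp (-hazard ε δ G S z u) * Real.exp (-t + hazard ε δ G S z u) := by
          gcongr
          exact nodeSurvival_le_exp h z u
      _ = Real.exp (-t) := by
          rw [← Real.exp_add]
          congr 1
          ring
  have hsum : ∀ z, ∑ R ∈ S.powerset,
      ENNReal.ofReal (setWeight S (nodeSurvival ε δ θ G S z) R) * F R ≤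
      ENNReal.ofReal (Real.exp (budget n ε δ m a b)) * (∑ R ∈ S.powerset,
        ENNReal.ofReal (setWeight S (nodeSurvival ε δ θ G' S (z + Δ)) R) * F' R) +
      (ENNReal.ofReal (Real.exp (-a) + Real.exp (-b)) + ∑ R ∈ S.powerset,
        ENNReal.ofReal (setWeight S (nodeSurvival ε δ θ G S z) R) * ENNReal.ofReal (Ψ R)) := by
    intro z
    refine (Finset.sum_le_sum fun R hR => hc.outcome_le (θ := θ) hε h hx hy hΨ ha hb hF hboth hnot
      (z := z) (z' := z + Δ) (by ring) (Finset.mem_powerset.1 hR)).trans ?_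
    rw [Finset.sum_add_distrib, ← Finset.mul_sum, sum_ofReal_setWeight_mul h z hΨ,
      ← ENNReal.ofReal_add (by positivity)
        (Finset.sum_nonneg fun R _ => mul_nonneg (hw0 z R) (hΨ R)),
      ← ENNReal.ofReal_sum_of_nonneg]
    · gcongr
      rw [Finset.sum_add_distrib, Finset.sum_add_distrib, ← Finset.sum_mul, ← Finset.sum_mul]
      gcongr
      · exact hsurv hx a z
      · exact hsurv hy b z
    · intro R _
      have := hw0 z R
      have := hΨ R
      split_ifs <;> positivity
  have hG' : phaseMean ε δ θ G' S F' = ∫⁻ z, ENNReal.ofReal (lap (z + Δ)) *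
      ∑ R ∈ S.powerset, ENNReal.ofReal (setWeight S (nodeSurvival ε δ θ G' S (z + Δ)) R) * F' R :=
    (lintegral_add_right_eq_self (fun z => ENNReal.ofReal (lap z) *
      ∑ R ∈ S.powerset, ENNReal.ofReal (setWeight S (nodeSurvival ε δ θ G' S z) R) * F' R) Δ).symm
  have hm1 : Measurable fun z => ENNReal.ofReal (lap (z + Δ)) * ∑ R ∈ S.powerset,
      ENNReal.ofReal (setWeight S (nodeSurvival ε δ θ G' S (z + Δ)) R) * F' R :=
    (hlapm.mul (measurable_sum_setWeight F')).comp (measurable_add_const Δ)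
  calc phaseMean ε δ θ G S F
      ≤ ∫⁻ z, (ENNReal.ofReal (Real.exp (budget n ε δ (m + 1) a b)) *
          (ENNReal.ofReal (lap (z + Δ)) * ∑ R ∈ S.powerset,
            ENNReal.ofReal (setWeight S (nodeSurvival ε δ θ G' S (z + Δ)) R) * F' R) +
          (ENNReal.ofReal (Real.exp (-a) + Real.exp (-b)) * ENNReal.ofReal (lap z) +
            ENNReal.ofReal (lap z) * ∑ R ∈ S.powerset,
              ENNReal.ofReal (setWeight S (nodeSurvival ε δ θ G S z) R) *
                ENNReal.ofReal (Ψ R))) := by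
        refine lintegral_mono fun z => ?_
        refine (mul_le_mul_right (hsum z) (ENNReal.ofReal (lap z))).trans ?_
        rw [mul_add, mul_add, mul_comm (ENNReal.ofReal (lap z)) (ENNReal.ofReal (_ + _)),
          ← mul_assoc, ← mul_assoc, ← ENNReal.ofReal_mul (hlap0 z),
          ← ENNReal.ofReal_mul (Real.exp_nonneg _)]
        refine add_le_add_left (mul_le_mul_left (ENNReal.ofReal_le_ofReal ?_) _) _
        have hl := hc.laplaceDensity_le hn hε hne z
        calc lap z * Real.exp (budget n ε δ m a b)
            ≤ (Real.exp (ε / (4 * Real.log n)) * lap (z + Δ)) *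
              Real.exp (budget n ε δ m a b) := by gcongr
          _ = Real.exp (budget n ε δ (m + 1) a b) * lap (z + Δ) := by
              have : budget n ε δ (m + 1) a b =
                  ε / (4 * Real.log n) + budget n ε δ m a b := by
                unfold budget
                push_cast
                ring
              rw [this, Real.exp_add]
              ring
    _ = _ := by
        rw [lintegral_add_left (hm1.const_mul _), lintegral_add_left (hlapm.const_mul _),
          lintegral_const_mul _ hm1, lintegral_const_mul _ hlapm, hG',
          lintegral_laplaceDensity (noiseScale_pos hn hε hne.card_pos), mul_one]
        rfl

/-- The privacy inequality from a common state containing both endpoints. The error terms bound the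
probabilities that an endpoint survives more than `a` or `b` further expected successes, and that
both are still present after `m` more phases; `r` is a bound for the shrinking factor. -/
theorem EdgeClose.runValue_le (hc : EdgeClose G G' x y) (hn : 2 ≤ Fintype.card V) (hε : 0 < ε)
    (h : 0 < epsPrime ε δ) {r : ℝ} (hr0 : 0 ≤ r)
    (hr : ∀ s, 2 ≤ s → s ≤ Fintype.card V → shrinkFactor (Fintype.card V) s ≤ r)
    (A : Set (Finset V)) (k m : ℕ) (a b : ℝ) (S : Finset V) (L : List (Finset V))
    (hx : x ∈ S) (hy : y ∈ S) :
    runValue ε δ θ G (outputValue ε A) k ⟨S, trajectory G L⟩ ≤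
      ENNReal.ofReal (Real.exp (budget (Fintype.card V) ε δ m a b)) *
        runValue ε δ θ G' (outputValue ε A) k ⟨S, trajectory G' L⟩ +
      ENNReal.ofReal (Real.exp (-a) + Real.exp (-b) + (S.card / 2 : ℝ) ^ 4 * r ^ m) := by
  induction k generalizing S L m a b with
  | zero =>
    have : runValue ε δ θ G (outputValue ε A) 0 ⟨S, trajectory G L⟩ = 0 :=
      if_neg (Finset.ne_empty_of_mem hx)
    rw [this]
    exact zero_le
  | succ k ih =>
    have hcard : 2 ≤ S.card := Finset.one_lt_card.2 ⟨x, hx, y, hy, hc.ne⟩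
    have hcard' : (2 : ℝ) ≤ S.card := by exact_mod_cast hcard
    -- the statement is trivial as soon as the error is at least one
    have htriv : 1 ≤ Real.exp (-a) + Real.exp (-b) + (S.card / 2 : ℝ) ^ 4 * r ^ m →
        runValue ε δ θ G (outputValue ε A) (k + 1) ⟨S, trajectory G L⟩ ≤
          ENNReal.ofReal (Real.exp (budget (Fintype.card V) ε δ m a b)) *
            runValue ε δ θ G' (outputValue ε A) (k + 1) ⟨S, trajectory G' L⟩ +
          ENNReal.ofReal (Real.exp (-a) + Real.exp (-b) + (S.card / 2 : ℝ) ^ 4 * r ^ m) := by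
      intro h1
      refine (runValue_le_one hn hε h (outputValue_le_one A) _ _).trans ?_
      refine le_add_of_nonneg_of_le zero_le ?_
      rw [← ENNReal.ofReal_one]
      exact ENNReal.ofReal_le_ofReal h1
    have hΨ0 : 0 ≤ (S.card / 2 : ℝ) ^ 4 * r ^ m := by positivity
    rcases lt_or_ge a 0 with ha | ha
    · refine htriv ?_
      have := Real.one_le_exp (x := -a) (by linarith)
      linarith [Real.exp_pos (-b)]
    rcases lt_or_ge b 0 with hb | hb
    · refine htriv ?_
      have := Real.one_le_exp (x := -b) (by linarith)
      linarith [Real.exp_pos (-a)]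
    cases m with
    | zero =>
      refine htriv ?_
      have : (1 : ℝ) ≤ (S.card / 2 : ℝ) ^ 4 := one_le_pow₀ (by linarith)
      rw [pow_zero, mul_one]
      linarith [Real.exp_pos (-a), Real.exp_pos (-b)]
    | succ m =>
      have hne : S.Nonempty := ⟨x, hx⟩
      rw [runValue_succ h _ _ hne, runValue_succ h _ _ hne, trajectory_append_singleton,
        trajectory_append_singleton]
      refine (hc.phaseMean_le hn hε h hx hy (Ψ := fun R => (R.card / 2 : ℝ) ^ 4 * r ^ m)
        (fun R => by positivity) ha hb
        (fun R => runValue_le_one hn hε h (outputValue_le_one A) _ _)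
        (fun R hR hxR hyR a b => ih m a b R _ hxR hyR)
        (fun R hR hnot => hc.runValue_le_of_not_mem hε h A k R _ hnot)).trans ?_
      gcongr
      rw [ENNReal.ofReal_add (by positivity) hΨ0]
      gcongr
      have hsplit : ∀ R : Finset V, ENNReal.ofReal ((R.card / 2 : ℝ) ^ 4 * r ^ m) =
          ENNReal.ofReal (r ^ m / 16) * ENNReal.ofReal ((R.card : ℝ) ^ 4) := by
        intro R
        rw [← ENNReal.ofReal_mul (by positivity)]
        congr 1
        ring
      simp only [hsplit]
      rw [phaseMean_const_mul]
      refine (mul_le_mul_right (phaseMean_card_pow_le hn hε h hne) _).trans ?_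
      rw [← ENNReal.ofReal_mul (by positivity)]
      refine ENNReal.ofReal_le_ofReal ?_
      calc r ^ m / 16 * ((S.card : ℝ) ^ 4 * shrinkFactor (Fintype.card V) S.card)
          ≤ r ^ m / 16 * ((S.card : ℝ) ^ 4 * r) := by
            gcongr
            exact hr _ hcard (Finset.card_le_univ S)
        _ = _ := by ring

end induction

/-! ### The choice of the budgets -/

section parameters

variable {ε δ : ℝ}

lemma log_four_div_ge (hδ0 : 0 < δ) (hδ1 : δ < 1) : 1.386 ≤ Real.log (4 / δ) := by
  have h4 : Real.log 4 = 2 * Real.log 2 := by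
    rw [show (4 : ℝ) = 2 ^ 2 by norm_num, Real.log_pow]
    norm_num
  have h1 : Real.log 4 ≤ Real.log (4 / δ) := by
    apply Real.log_le_log (by norm_num)
    rw [le_div_iff₀ hδ0]
    linarith
  have := Real.log_two_gt_d9
  linarith

lemma epsPrime_pos (hε : 0 < ε) (hδ0 : 0 < δ) (hδ1 : δ < 1) : 0 < epsPrime ε δ := by
  have h1 := log_four_div_ge hδ0 hδ1
  have h2 := exp_neg_one_lt_one
  unfold epsPrime
  apply div_pos (mul_pos (by linarith) hε)
  linarith

lemma epsPrime_le (hε : 0 < ε) (hδ0 : 0 < δ) (hδ1 : δ < 1) : epsPrime ε δ ≤ 0.0191 * ε := by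
  have h1 := log_four_div_ge hδ0 hδ1
  have h2 := Real.exp_neg_one_gt_d9
  unfold epsPrime
  rw [div_le_iff₀ (by linarith)]
  nlinarith

lemma survivalCost_mul_log_le (hε : 0 < ε) (hε1 : ε ≤ 1) (hδ0 : 0 < δ) (hδ1 : δ < 1) :
    survivalCost ε δ * Real.log (4 / δ) ≤ 1.02 * (ε / 24) := by
  have hL := log_four_div_ge hδ0 hδ1
  have he0 := epsPrime_pos hε hδ0 hδ1
  have he1 := epsPrime_le hε hδ0 hδ1
  have hd : 0 < 1 - Real.exp (-1) := by linarith [exp_neg_one_lt_one]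
  have hprod : epsPrime ε δ * Real.log (4 / δ) = (1 - Real.exp (-1)) * (ε / 24) := by
    unfold epsPrime
    field_simp
  have hexp : Real.exp (epsPrime ε δ) - 1 ≤ 1.02 * epsPrime ε δ := by
    have h1 := Real.abs_exp_sub_one_sub_id_le (x := epsPrime ε δ)
      (by rw [abs_of_pos he0]; linarith)
    have h2 := (abs_le.1 h1).2
    nlinarith
  unfold survivalCost
  rw [div_mul_eq_mul_div, div_le_iff₀ hd]
  calc _ ≤ 1.02 * epsPrime ε δ * Real.log (4 / δ) := by gcongr
    _ = 1.02 * (epsPrime ε δ * Real.log (4 / δ)) := by ring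
    _ = _ := by
      rw [hprod]
      ring

/-- The number of phases for which the noise is paid: as large as the budget allows, and large enough
for the size to fall below two by halving, with some phases to spare for failures. -/
def phaseBudget (n : ℕ) : ℕ := ⌊2.5 * Real.log n⌋₊

lemma budget_le {n : ℕ} (hn : 2 ≤ n) (hε : 0 < ε) (hε1 : ε ≤ 1) (hδ0 : 0 < δ) (hδ1 : δ < 1) :
    budget n ε δ (phaseBudget n) (Real.log (4 / δ)) (Real.log (4 / δ)) ≤ ε := by
  have hlog : 0 < Real.log n := Real.log_pos (by exact_mod_cast hn)
  have h1 : (phaseBudget n : ℝ) ≤ 2.5 * Real.log n := Nat.floor_le (by positivity)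
  have h2 : phaseBudget n * (ε / (4 * Real.log n)) ≤ 0.625 * ε := by
    calc phaseBudget n * (ε / (4 * Real.log n)) ≤ 2.5 * Real.log n * (ε / (4 * Real.log n)) := by
          gcongr
      _ = 0.625 * ε := by
          field_simp
          norm_num
  have h3 := epsPrime_le hε hδ0 hδ1
  have h4 := survivalCost_mul_log_le hε hε1 hδ0 hδ1
  unfold budget
  linarith

/-- An upper bound for the shrinking factor of phases with at least two nodes. -/
def shrinkBound (n : ℕ) : ℝ := 1 / 16 + 1.45 / n ^ 3 + 0.0004

lemma shrinkFactor_le_shrinkBound {n s : ℕ} (hs : 2 ≤ s) (hsn : s ≤ n) :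
    shrinkFactor n s ≤ shrinkBound n := by
  refine (shrinkFactor_le hsn (by omega)).trans ?_
  have hs' : (2 : ℝ) ≤ s := by exact_mod_cast hs
  have h : Real.exp (-(4 * s)) ≤ 0.0004 := by
    calc Real.exp (-(4 * s)) ≤ Real.exp ((8 : ℕ) * (-1)) := by
          apply Real.exp_le_exp.2
          push_cast
          linarith
      _ = Real.exp (-1) ^ 8 := Real.exp_nat_mul _ _
      _ ≤ 0.368 ^ 8 := by
          have := Real.exp_neg_one_lt_d9
          gcongr
          linarith
      _ ≤ 0.0004 := by norm_num
  unfold shrinkBound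
  linarith

lemma exp_two_point_four_le : Real.exp 2.4 ≤ 11.5 := by
  refine le_of_pow_le_pow_left₀ (n := 5) (by norm_num) (by norm_num) ?_
  calc Real.exp 2.4 ^ 5 = Real.exp 1 ^ 12 := by
        rw [← Real.exp_nat_mul, ← Real.exp_nat_mul]
        norm_num
    _ ≤ 2.7183 ^ 12 := by
        have := Real.exp_one_lt_d9
        gcongr
        linarith
    _ ≤ 11.5 ^ 5 := by norm_num

/-- With this bound the fourth moment argument shows that both endpoints survive the budgeted phases
with probability at most `n⁻²`. The general estimate has no room for `n = 2, 3`. -/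
lemma shrinkBound_pow_le {n : ℕ} (hn : 2 ≤ n) :
    (n / 2 : ℝ) ^ 4 * shrinkBound n ^ phaseBudget n ≤ 1 / (n : ℝ) ^ 2 := by
  have hn' : (2 : ℝ) ≤ n := by exact_mod_cast hn
  have hr0 : 0 ≤ shrinkBound n := by unfold shrinkBound; positivity
  have hanti : shrinkBound n ≤ 1 → ∀ j : ℕ, (j : ℝ) ≤ 2.5 * Real.log n →
      shrinkBound n ^ phaseBudget n ≤ shrinkBound n ^ j := fun h1 j hj =>
    pow_le_pow_of_le_one hr0 h1 (Nat.le_floor hj)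
  rcases (by omega : n = 2 ∨ n = 3 ∨ 4 ≤ n) with rfl | rfl | h4
  · have hr : shrinkBound 2 ≤ 0.25 := by norm_num [shrinkBound]
    have h := hanti (by linarith) 1 (by
      have := Real.log_two_gt_d9
      push_cast
      linarith)
    push_cast
    rw [pow_one] at h
    norm_num
    linarith
  · have hr : shrinkBound 3 ≤ 0.12 := by norm_num [shrinkBound]
    have h := hanti (by linarith) 2 (by
      have h3 : 1 ≤ Real.log 3 := by
        rw [Real.le_log_iff_exp_le (by norm_num)]
        have := Real.exp_one_lt_d9
        linarith
      push_cast
      linarith)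
    have h2 : shrinkBound 3 ^ 2 ≤ 0.12 ^ 2 := by gcongr
    push_cast
    norm_num at h2 ⊢
    linarith
  · have h4' : (4 : ℝ) ≤ n := by exact_mod_cast h4
    have hr : shrinkBound n ≤ Real.exp (-2.4) := by
      have h1 : (1.45 : ℝ) / n ^ 3 ≤ 1.45 / 4 ^ 3 := by gcongr
      have h2 : (11.5 : ℝ)⁻¹ ≤ Real.exp (-2.4) := by
        rw [Real.exp_neg]
        exact inv_anti₀ (Real.exp_pos _) exp_two_point_four_le
      unfold shrinkBound
      norm_num at h1 h2 ⊢
      linarith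
    have hm : 2.5 * Real.log n < phaseBudget n + 1 := Nat.lt_floor_add_one _
    calc (n / 2 : ℝ) ^ 4 * shrinkBound n ^ phaseBudget n
        ≤ (n / 2 : ℝ) ^ 4 * Real.exp (-2.4) ^ phaseBudget n := by gcongr
      _ ≤ (n / 2 : ℝ) ^ 4 * (16 / (n : ℝ) ^ 6) := by
          gcongr
          rw [← Real.exp_nat_mul]
          calc Real.exp (phaseBudget n * (-2.4)) ≤ Real.exp (2.4 - (6 : ℕ) * Real.log n) := by
                apply Real.exp_le_exp.2
                push_cast
                linarith
            _ = Real.exp 2.4 / (n : ℝ) ^ 6 := by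
                rw [Real.exp_sub, Real.exp_nat_mul, Real.exp_log (by linarith)]
            _ ≤ 16 / (n : ℝ) ^ 6 := by
                have := exp_two_point_four_le
                gcongr
                linarith
      _ = 1 / (n : ℝ) ^ 2 := by
          field_simp
          norm_num

end parameters

section privacy

variable {V : Type*} [Fintype V] {ε δ θ : ℝ}

lemma mrOutputProb_eq (G : SimpleGraph V) (A : Set (Finset V)) :
    mrOutputProb ε δ θ G A =
      ⨆ k, runValue ε δ θ G (outputValue ε A) k ⟨Finset.univ, trajectory G []⟩ := by
  unfold mrOutputProb
  congr 1
  funext k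
  refine Eq.trans (lintegral_congr fun σ => ?_) (lintegral_mrLaw (outputValue ε A) k)
  by_cases hσ : currentNodes σ.records = ∅
  · exact (if_pos hσ).trans (if_pos (c := σ.toPhaseState.current = ∅) hσ).symm
  · exact (if_neg hσ).trans (if_neg (c := σ.toPhaseState.current = ∅) hσ).symm

theorem isDifferentiallyPrivate_mrOutputProb (hn : 2 ≤ Fintype.card V) (hε : 0 < ε) (hε1 : ε ≤ 1)
    (hδn : 2 / (Fintype.card V : ℝ) ^ 2 < δ) (hδ1 : δ < 1) :
    IsDifferentiallyPrivate (mrOutputProb (V := V) ε δ θ) ε δ := by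
  intro G G' hGG' A
  obtain ⟨x, y, hc⟩ := hGG'.edgeClose
  have hδ0 : 0 < δ := lt_of_le_of_lt (by positivity) hδn
  have h := epsPrime_pos hε hδ0 hδ1
  rw [mrOutputProb_eq, mrOutputProb_eq]
  refine iSup_le fun k => ?_
  refine (hc.runValue_le hn hε h (r := shrinkBound (Fintype.card V))
    (by unfold shrinkBound; positivity) (fun s => shrinkFactor_le_shrinkBound) A k
    (phaseBudget (Fintype.card V)) (Real.log (4 / δ)) (Real.log (4 / δ)) Finset.univ []
    (Finset.mem_univ x) (Finset.mem_univ y)).trans ?_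
  gcongr
  · exact budget_le hn hε hε1 hδ0 hδ1
  · exact le_iSup (fun k => runValue ε δ θ G' (outputValue ε A) k
      ⟨Finset.univ, trajectory G' []⟩) k
  · have h1 := shrinkBound_pow_le hn
    have h2 : Real.exp (-Real.log (4 / δ)) = δ / 4 := by
      rw [Real.exp_neg, Real.exp_log (by positivity), inv_div]
    have h3 : 2 / (Fintype.card V : ℝ) ^ 2 = 2 * (1 / (Fintype.card V : ℝ) ^ 2) := by ring
    rw [Finset.card_univ, h2]
    linarith

end privacy

end DenseDP

end

theorem mainTheorem8 :
    ∃ C : ℝ, 0 < C ∧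
      ∀ (V : Type*) [Fintype V] [Nonempty V] (ε δ θ : ℝ),
        0 < ε → ε ≤ 1 → 2 / (Fintype.card V : ℝ) ^ 2 < δ → δ < 1 →
        0 ≤ θ → θ ≤ Real.log (Fintype.card V) →
        DenseDP.IsDifferentiallyPrivate (DenseDP.mrOutputProb (V := V) ε δ θ) ε δ ∧
        ∀ G : SimpleGraph V,
          ENNReal.ofReal (1 - 1 / (Fintype.card V : ℝ) ^ 2) ≤
            DenseDP.mrPhasesAtMost ε δ θ G (C * Real.log (Fintype.card V)) ∧
          ∀ k : ℕ,
            (DenseDP.mrLaw ε δ θ G k).map DenseDP.MRState.toPhaseState =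
              DenseDP.directLaw ε δ θ G k := by
  refine ⟨8, by norm_num, fun V _ _ ε δ θ hε hε1 hδn hδ1 _ _ => ?_⟩
  have hδ0 : 0 < δ := lt_of_le_of_lt (by positivity) hδn
  -- for a single node the interval of admissible `δ` is empty
  have hn : 2 ≤ Fintype.card V := by
    have hpos : 0 < Fintype.card V := Fintype.card_pos
    by_contra hlt
    have h1 : Fintype.card V = 1 := by omega
    rw [h1] at hδn
    norm_num at hδn
    linarith
  exact ⟨DenseDP.isDifferentiallyPrivate_mrOutputProb hn hε hε1 hδn hδ1, fun G =>
    ⟨DenseDP.mrPhasesAtMost_ge hn hε (DenseDP.epsPrime_pos hε hδ0 hδ1) G,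
      DenseDP.map_mrLaw ε δ θ G⟩⟩
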